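/- **Definitions.** An *interval system* $\mathcal I$ is a finite collection of non-empty open intervals contained in $(0,1)$, no two of which share an endpoint. Two intervals *overlap* if they intersect and neither is contained in the other; the *overlap graph* of $\mathcal I$ has vertex set $\mathcal I$, two intervals being adjacent when they overlap. (Circle graphs are exactly the graphs isomorphic to overlap graphs of interval systems.) For $\mathcal T\subseteq\mathcal I$ let $\omega(\mathcal T)$ be the largest number of pairwise overlapping intervals in $\mathcal T$. For $I=(\ell,r)$ and $I'=(\ell',r')$ write $I\prec I'$ if $\ell<\ell'$ and $r<r'$; the height of $I$ in $\mathcal T$ is the maximum number of elements of a $\prec$-chain in $\mathcal T$ ending in $I$. A *pillar* is a point of $(0,1)$ that is not an endpoint of an interval of $\mathcal I$. Let $P$ be a finite set of pillars with a total order $\preceq$. An interval of $\mathcal I$ is *assigned* to $p\in P$ if it contains $p$ and no $p'\in P$ with $p'\prec p$; let $\mathcal I_p$ be the set of intervals assigned to $p$. The *foundation* $F_p$ is the open interval containing $p$ with endpoints in $\{0,1\}\cup\{p'\in P: p'\prec p\}$ that contains no $p'\in P$ with $p'\prec p$. Going through $P$ in the order $\preceq$, let $C_p=\{c_1<c_2<\dots\}$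 be the set of the $\omega(\mathcal I_p)$ smallest positive integers that have not been used at earlier pillars to colour an interval with exactly one endpoint in $F_p$, and give each $I\in\mathcal I_p$ the colour $c_h$, where $h$ is the height of $I$ in $\mathcal I_p$. The resulting partial colouring of $\mathcal I$ is called $\psi=\psi_{(P,\preceq)}$, and $(P,\preceq,\psi)$ is a *pillar assignment* of $\mathcal I$. It is *complete* if every interval of $\mathcal I$ contains a pillar of $P$. Let $\chi(P,\preceq,\psi)$ be the number of colours used by $\psi$. An *arch* is a non-empty open interval with endpoints in $\{0,1\}\cup P$ that contains no pillar of $P$; its *degree* $d_{(P,\preceq,\psi)}(K)$ is the number of colours that $\psi$ gives to intervals of $\mathcal I$ with an endpoint in $K$. A pillar assignment $(P^*,\preceq^*,\psi^*)$ *extends* $(P,\preceq,\psi)$ if $P\subseteq P^*$, $\preceq^*$ restricts to $\preceq$ on $P$, every pillar of $P$ precedes every pillar of $P^*\setminus P$ in $\preceq^*$, and $\psi^*$ is a proper partial colouring (no two overlapping intervals get the same colour) that extends $\psi$. **Theorem.** Let $\mathcal I$ be an interval system and let $G$ be (a graph isomorphic to) its overlap graph. Suppose that $G$ has clique number at most $3$.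 Let $(P,\preceq,\psi)$ be a pillar assignment of $\mathcal I$ with $\chi(P,\preceq,\psi)\le 19$ and with $d_{(P,\preceq,\psi)}(K)\le 13$ for every arch $K$. Then there is a complete pillar assignment $(P^*,\preceq^*,\psi^*)$ of $\mathcal I$ that extends $(P,\preceq,\psi)$ and satisfies $\chi(P^*,\preceq^*,\psi^*)\le 19$. Moreover, every such $G$ is $19$-colourable; that is, $K_4$-free circle graphs are $19$-colourable. -/

import Mathlib

noncomputable section

/-- Two open intervals `(I.1, I.2)` and `(J.1, J.2)` overlap if they have non-empty intersection
and neither is contained in the other. -/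
def Overlap (I J : ℝ × ℝ) : Prop :=
  (Set.Ioo I.1 I.2 ∩ Set.Ioo J.1 J.2).Nonempty ∧
    ¬ Set.Ioo I.1 I.2 ⊆ Set.Ioo J.1 J.2 ∧ ¬ Set.Ioo J.1 J.2 ⊆ Set.Ioo I.1 I.2

theorem Overlap.symm {I J : ℝ × ℝ} (h : Overlap I J) : Overlap J I :=
  ⟨by rw [Set.inter_comm]; exact h.1, h.2.2, h.2.1⟩

theorem Overlap.irrefl (I : ℝ × ℝ) : ¬ Overlap I I := fun h => h.2.1 subset_rfl

/-- A (finite) interval system: a finite collection of non-empty open intervals contained in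
`(0,1)`, no two of which share an endpoint. The pair `(l, r)` stands for the open interval with
endpoints `l < r`. -/
structure IntervalSystem where
  intervals : Finset (ℝ × ℝ)
  nonneg : ∀ I ∈ intervals, 0 ≤ I.1
  lt : ∀ I ∈ intervals, I.1 < I.2
  le_one : ∀ I ∈ intervals, I.2 ≤ 1
  endpoints_ne : ∀ I ∈ intervals, ∀ J ∈ intervals, I ≠ J →
    I.1 ≠ J.1 ∧ I.1 ≠ J.2 ∧ I.2 ≠ J.1 ∧ I.2 ≠ J.2

/-- The overlap graph of an interval system. -/
def IntervalSystem.overlapGraph (S : IntervalSystem) : SimpleGraph {I // I ∈ S.intervals} where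
  Adj I J := Overlap I.1 J.1
  symm := ⟨fun _ _ h => h.symm⟩
  loopless := ⟨fun I => Overlap.irrefl I.1⟩

/-- The size of the largest set of pairwise overlapping intervals contained in `T`. -/
def cliqueNumber (T : Finset (ℝ × ℝ)) : ℕ :=
  open scoped Classical in
  (T.powerset.filter fun U : Finset (ℝ × ℝ) => (U : Set (ℝ × ℝ)).Pairwise Overlap).sup Finset.card

/-- The strict part of the partial order on intervals:
`I` precedes `J` when `ℓ(I) < ℓ(J)` and `r(I) < r(J)`. -/
def Precedes (I J : ℝ × ℝ) : Prop := I.1 < J.1 ∧ I.2 < J.2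

/-- The height of `I` in `T`: the maximum number of elements of a chain of `T` that ends in `I`. -/
def height (T : Finset (ℝ × ℝ)) (I : ℝ × ℝ) : ℕ :=
  open scoped Classical in
  (T.powerset.filter fun U : Finset (ℝ × ℝ) => I ∈ U ∧ IsChain Precedes (U : Set (ℝ × ℝ)) ∧
    ∀ J ∈ U, J = I ∨ Precedes J I).sup Finset.card

/-- The set of the `w` smallest positive integers that are not in `X`. -/
def smallestColours (X : Finset ℕ) (w : ℕ) : Finset ℕ :=
  (Finset.range w).image (Nat.nth fun c => 0 < c ∧ c ∉ X)

/-- The colouring of a set `T` of intervals with a common point from the colours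
`c₁ < ⋯ < c_ω` of `C`, where `ω = |C|` is the clique number of `T`:
the interval `I` gets the colour `c_h`, with `h` the height of `I` in `T`. -/
def permutationColouring (T : Finset (ℝ × ℝ)) (C : Finset ℕ) (I : ℝ × ℝ) : ℕ :=
  Nat.nth (fun c => c ∈ C) (height T I - 1)

/-- The colours that a partial colouring `ψ` uses on the intervals of `T`. -/
def coloursUsed (ψ : ℝ × ℝ → Option ℕ) (T : Finset (ℝ × ℝ)) : Finset ℕ :=
  (T.image ψ).eraseNone

/-- No pair of overlapping intervals of the system receives the same colour. -/
def IntervalSystem.IsProperPartialColouring (S : IntervalSystem) (ψ : ℝ × ℝ → Option ℕ) : Prop :=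
  ∀ I ∈ S.intervals, ∀ J ∈ S.intervals, Overlap I J → ∀ c : ℕ, ψ I = some c → ψ J ≠ some c

namespace IntervalSystem

/-- A point is a pillar of `S` if it lies in `(0,1)` and is not an endpoint of an interval. -/
def IsPillar (S : IntervalSystem) (p : ℝ) : Prop :=
  p ∈ Set.Ioo (0 : ℝ) 1 ∧ ∀ I ∈ S.intervals, p ≠ I.1 ∧ p ≠ I.2

/-- The intervals that are assigned to `p`, where `prev` lists the pillars preceding `p`:
those that contain `p` and no earlier pillar. -/
def assigned (S : IntervalSystem) (prev : List ℝ) (p : ℝ) : Finset (ℝ × ℝ) :=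
  open scoped Classical in
  S.intervals.filter fun I => p ∈ Set.Ioo I.1 I.2 ∧ ∀ q ∈ prev, q ∉ Set.Ioo I.1 I.2

/-- The foundation of `p`, where `prev` lists the pillars preceding `p`: the open interval around
`p` whose endpoints are the nearest points of `prev ∪ {0, 1}` to the left and right of `p`. -/
def foundation (prev : List ℝ) (p : ℝ) : Set ℝ :=
  open scoped Classical in
  Set.Ioo ((prev.filter fun q => q < p).foldr max 0) ((prev.filter fun q => p < q).foldr min 1)

/-- The intervals of `S` with exactly one endpoint in `F`. -/
def oneEndpointIn (S : IntervalSystem) (F : Set ℝ) : Finset (ℝ × ℝ) :=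
  open scoped Classical in
  S.intervals.filter fun I => (I.1 ∈ F ∧ I.2 ∉ F) ∨ (I.1 ∉ F ∧ I.2 ∈ F)

/-- The partial colouring obtained from totally ordered pillars, which are listed here from the
last one to the first one. When `p` is added after `prev`, the intervals assigned to `p` are
coloured, according to their heights, with as many colours as their clique number, namely the
smallest positive integers not used on the intervals with exactly one endpoint in the foundation
of `p`. Uncoloured intervals get the value `none`. -/
def colouringRev (S : IntervalSystem) : List ℝ → ℝ × ℝ → Option ℕ
  | [] => fun _ => none
  | p :: prev => fun I =>
      open scoped Classical in
      if I ∈ S.assigned prev p then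
        some (permutationColouring (S.assigned prev p)
          (smallestColours
            (coloursUsed (colouringRev S prev) (S.oneEndpointIn (foundation prev p)))
            (cliqueNumber (S.assigned prev p))) I)
      else colouringRev S prev I

/-- A pillar assignment of `S`. The finite totally ordered set of pillars is given by the
duplicate-free list of its elements in increasing order with respect to its total order (which is
unrelated to the order of the real line). The colouring, which is determined by the ordered
pillars, is `PillarAssignment.ψ` below. -/
structure PillarAssignment (S : IntervalSystem) where
  pillars : List ℝ
  nodup : pillars.Nodup
  isPillar : ∀ p ∈ pillars, S.IsPillar p

namespace PillarAssignment

variable {S : IntervalSystem}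

/-- The partial colouring given by the ordered pillars. -/
def ψ (A : S.PillarAssignment) : ℝ × ℝ → Option ℕ := S.colouringRev A.pillars.reverse

/-- The number of colours that the pillar assignment uses. -/
def numColours (A : S.PillarAssignment) : ℕ := (coloursUsed A.ψ S.intervals).card

/-- Every interval of the system contains a pillar. -/
def IsComplete (A : S.PillarAssignment) : Prop :=
  ∀ I ∈ S.intervals, ∃ p ∈ A.pillars, p ∈ Set.Ioo I.1 I.2

/-- The open interval `(a, b)` is an arch: its endpoints are in `{0, 1} ∪ P` and it contains no
pillar of `P`. -/
def IsArch (A : S.PillarAssignment) (a b : ℝ) : Prop :=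
  a < b ∧ (a = 0 ∨ a = 1 ∨ a ∈ A.pillars) ∧ (b = 0 ∨ b = 1 ∨ b ∈ A.pillars) ∧
    ∀ p ∈ A.pillars, p ∉ Set.Ioo a b

/-- The degree of `J`: the number of colours that intervals with an endpoint in `J` receive. -/
def degree (A : S.PillarAssignment) (J : Set ℝ) : ℕ :=
  open scoped Classical in
  (coloursUsed A.ψ (S.intervals.filter fun I => I.1 ∈ J ∨ I.2 ∈ J)).card

/-- `B` extends `A`: the pillars of `A`, in their order, form an initial segment of the ordered
pillars of `B`, and the colouring of `B` is a proper partial colouring that extends that of `A`. -/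
def Extends (B A : S.PillarAssignment) : Prop :=
  A.pillars <+: B.pillars ∧ S.IsProperPartialColouring B.ψ ∧
    ∀ I ∈ S.intervals, ∀ c : ℕ, A.ψ I = some c → B.ψ I = some c

end PillarAssignment

end IntervalSystem

end

/-!
The proof completes a pillar assignment step by step, keeping all colours at most `19` and all
degrees of arches at most `13`. It is enough to treat one arch `K = (a, b)` that contains an
interval without a pillar, and to add pillars inside `K` so that a further interval is covered.

*Chords.* The coloured intervals with an endpoint in `K` cross the boundary of `K`, because they
contain a pillar. They are chords of a circle, with one end in `K` and the other outside. Each has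
a label, consisting of its pillar and its height. Within `K`, colours and labels determine each
other (`label_eq_of_colouringRev_eq`). The outer ends of chords with different pillars are separated
by pillars (`label_notMem_or`), and a chord of height `h` has chords of all smaller heights below
it. Hence, in the order of labels by pillar (along the circle) and then height, four chords whose
labels and inner ends both increase strictly give four pairwise overlapping intervals
(`false_of_increasing_crossers`).

*Cuts.* Cut `K` greedily into pieces with at most seven colours. Eight pieces with exactly seven
colours would occupy `56` cells of the grid of `13` labels and `8` pieces, and any `55` cells contain
four that increase strictly in both coordinates, because a diagonal contains four of them
(`exists_increasing_cells`). So at most seven cuts are needed (`exists_cuts`). Each cut is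
placed immediately before the inner end of a chord. All uncoloured intervals through the cut
overlap that chord, so that a pillar at the cut needs only two colours instead of three
(`IsCheap.cliqueNumber_le`).

*Balanced insertion.* Adding the at most seven cuts as pillars, medians first, gives a binary tree of
depth three. The palettes then use at most `13 + 3 * 2 = 19` colours, and the final arches have degree
at most `7 + 3 * 2 = 13` (`exists_prefix_of_isCheap`). If these pillars cover no new interval, then no
degree has changed, the new arches have degree at most seven, and any pillar in an uncovered
interval can be added, at the cost of three colours (`exists_uncovered_card_lt`).

Pillar assignments always give proper colourings (`isProperPartialColouring_colouringRev`), and the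
colours used form an initial segment of the positive integers
(`exists_colouringRev_eq_of_lt`), so a bound on their number bounds the colours themselves.
Colourability follows by starting without pillars.
-/

open Set

/-! ### Overlapping intervals and heights -/

theorem mem_coloursUsed {ψ : ℝ × ℝ → Option ℕ} {T : Finset (ℝ × ℝ)} {c : ℕ} :
    c ∈ coloursUsed ψ T ↔ ∃ I ∈ T, ψ I = some c := by
  simp [coloursUsed]

theorem coloursUsed_mono {ψ : ℝ × ℝ → Option ℕ} {T U : Finset (ℝ × ℝ)} (h : T ⊆ U) :
    coloursUsed ψ T ⊆ coloursUsed ψ U := by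
  intro c hc
  obtain ⟨I, hI, hc⟩ := mem_coloursUsed.1 hc
  exact mem_coloursUsed.2 ⟨I, h hI, hc⟩

/-- An interval with an endpoint inside another one, and a point outside it, overlaps it. -/
theorem overlap_of_endpoint_mem {I J : ℝ × ℝ} {t r : ℝ} (hI : I.1 < I.2)
    (ht : t ∈ Ioo J.1 J.2) (htI : t = I.1 ∨ t = I.2) (hr : r ∈ Ioo I.1 I.2)
    (hrJ : r ∉ Ioo J.1 J.2) : Overlap J I := by
  refine ⟨?_, fun h => ?_, fun h => hrJ (h hr)⟩
  · rcases htI with rfl | rfl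
    · obtain ⟨y, hy1, hy2⟩ := exists_between (lt_min ht.2 hI)
      exact ⟨y, ⟨ht.1.trans hy1, hy2.trans_le (min_le_left _ _)⟩, hy1,
        hy2.trans_le (min_le_right _ _)⟩
    · obtain ⟨y, hy1, hy2⟩ := exists_between (max_lt ht.1 hI)
      exact ⟨y, ⟨(le_max_left _ _).trans_lt hy1, hy2.trans ht.2⟩,
        (le_max_right _ _).trans_lt hy1, hy2⟩
  · rcases htI with rfl | rfl
    · exact lt_irrefl _ (h ht).1
    · exact lt_irrefl _ (h ht).2

theorem Precedes.trans {I J K : ℝ × ℝ} (h : Precedes I J) (h' : Precedes J K) : Precedes I K :=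
  ⟨h.1.trans h'.1, h.2.trans h'.2⟩

theorem Precedes.overlap {I J : ℝ × ℝ} (h : Precedes I J) (h' : J.1 < I.2) : Overlap I J := by
  refine overlap_of_endpoint_mem (h'.trans h.2) ⟨h.1, h'⟩ (Or.inl rfl)
    (r := I.2) ⟨h', h.2⟩ (fun h => lt_irrefl _ h.2)

theorem Overlap.precedes_or_precedes {I J : ℝ × ℝ} (h : Overlap I J) :
    Precedes I J ∨ Precedes J I := by
  obtain ⟨-, h1, h2⟩ := h
  by_contra hc
  simp only [Precedes, not_or, not_and, not_lt] at hc
  rcases lt_or_ge I.1 J.1 with h | h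
  · exact h2 (Ioo_subset_Ioo h.le (hc.1 h))
  · rcases h.eq_or_lt with h | h
    · rcases le_total I.2 J.2 with h' | h'
      · exact h1 (Ioo_subset_Ioo h.le h')
      · exact h2 (Ioo_subset_Ioo h.ge h')
    · exact h1 (Ioo_subset_Ioo h.le (hc.2 h))

theorem card_le_cliqueNumber {T U : Finset (ℝ × ℝ)} (hU : U ⊆ T)
    (h : (U : Set (ℝ × ℝ)).Pairwise Overlap) : U.card ≤ cliqueNumber T := by
  classical
  unfold cliqueNumber
  exact Finset.le_sup (f := Finset.card)
    (by simp only [Finset.mem_filter, Finset.mem_powerset]; exact ⟨hU, h⟩)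

theorem cliqueNumber_le {T : Finset (ℝ × ℝ)} {n : ℕ}
    (h : ∀ U ⊆ T, (U : Set (ℝ × ℝ)).Pairwise Overlap → U.card ≤ n) : cliqueNumber T ≤ n := by
  classical
  unfold cliqueNumber
  refine Finset.sup_le fun U hU => ?_
  simp only [Finset.mem_filter, Finset.mem_powerset] at hU
  exact h U hU.1 hU.2

theorem card_le_height {T U : Finset (ℝ × ℝ)} {I : ℝ × ℝ} (hU : U ⊆ T) (hI : I ∈ U)
    (h : IsChain Precedes (U : Set (ℝ × ℝ))) (h' : ∀ J ∈ U, J = I ∨ Precedes J I) :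
    U.card ≤ height T I := by
  classical
  unfold height
  exact Finset.le_sup (f := Finset.card)
    (by simp only [Finset.mem_filter, Finset.mem_powerset]; exact ⟨hU, hI, h, h'⟩)

theorem one_le_height {T : Finset (ℝ × ℝ)} {I : ℝ × ℝ} (hI : I ∈ T) : 1 ≤ height T I := by
  have := card_le_height (T := T) (U := {I}) (I := I) (by simpa using hI) (by simp)
    (by simp) (fun J hJ => Or.inl (by simpa using hJ))
  simpa using this

/-- The maximum in the definition of the height is attained. -/
theorem exists_chain_card_eq_height {T : Finset (ℝ × ℝ)} {I : ℝ × ℝ} (hI : I ∈ T) :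
    ∃ U ⊆ T, I ∈ U ∧ IsChain Precedes (U : Set (ℝ × ℝ)) ∧
      (∀ J ∈ U, J = I ∨ Precedes J I) ∧ U.card = height T I := by
  classical
  have hne : (T.powerset.filter fun U : Finset (ℝ × ℝ) => I ∈ U ∧
      IsChain Precedes (U : Set (ℝ × ℝ)) ∧ ∀ J ∈ U, J = I ∨ Precedes J I).Nonempty :=
    ⟨{I}, by simpa [hI] using fun a b h => Or.inl h⟩
  obtain ⟨U, hU, h⟩ := Finset.exists_mem_eq_sup _ hne Finset.card
  simp only [Finset.mem_filter, Finset.mem_powerset] at hU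
  refine ⟨U, hU.1, hU.2.1, hU.2.2.1, hU.2.2.2, ?_⟩
  unfold height
  rw [← h]

theorem height_lt_height {T : Finset (ℝ × ℝ)} {I J : ℝ × ℝ} (hI : I ∈ T) (hJ : J ∈ T)
    (h : Precedes I J) : height T I < height T J := by
  classical
  obtain ⟨U, hU, hIU, hc, hle, hcard⟩ := exists_chain_card_eq_height hI
  have hlt : ∀ K ∈ U, Precedes K J := fun K hK => by
    rcases hle K hK with rfl | h'
    · exact h
    · exact h'.trans h
  have hJU : J ∉ U := fun h' => lt_irrefl _ (hlt J h').1
  have := card_le_height (T := T) (U := insert J U) (I := J)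
    (Finset.insert_subset hJ hU) (by simp)
    (by
      rw [Finset.coe_insert]
      exact hc.insert fun K hK _ => Or.inr (hlt K hK))
    (by
      intro K hK
      rcases Finset.mem_insert.1 hK with rfl | hK
      · exact Or.inl rfl
      · exact Or.inr (hlt K hK))
  rw [Finset.card_insert_of_notMem hJU] at this
  omega

/-- All smaller positive heights are attained below an interval. -/
theorem exists_precedes_height_eq {T : Finset (ℝ × ℝ)} {h : ℕ} (h1 : 1 ≤ h) :
    ∀ (n : ℕ) {J : ℝ × ℝ}, J ∈ T → height T J = h + 1 + n →
      ∃ I ∈ T, Precedes I J ∧ height T I = h := by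
  classical
  -- one step down: remove the top element of a longest chain and take the new top
  have step : ∀ {J : ℝ × ℝ} {m : ℕ}, J ∈ T → 1 ≤ m → height T J = m + 1 →
      ∃ I ∈ T, Precedes I J ∧ height T I = m := by
    intro J m hJ hm hJm
    obtain ⟨U, hU, hJU, hc, hle, hcard⟩ := exists_chain_card_eq_height hJ
    have hcard' : (U.erase J).card = m := by
      rw [Finset.card_erase_of_mem hJU]; omega
    obtain ⟨I, hI, hmax⟩ := Finset.exists_max_image (U.erase J) Prod.fst
      (Finset.card_pos.1 (by omega))
    have hIU := Finset.mem_of_mem_erase hI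
    have hIJ : Precedes I J := (hle I hIU).resolve_left (Finset.ne_of_mem_erase hI)
    refine ⟨I, hU hIU, hIJ, le_antisymm ?_ ?_⟩
    · have := height_lt_height (hU hIU) hJ hIJ
      omega
    · rw [← hcard']
      refine card_le_height ((Finset.erase_subset _ _).trans hU) hI
        (hc.mono (by exact_mod_cast Finset.erase_subset _ _)) fun K hK => ?_
      by_cases hKI : K = I
      · exact Or.inl hKI
      · refine Or.inr ((hc (Finset.mem_of_mem_erase hK) hIU hKI).resolve_right fun hlt => ?_)
        exact absurd (hmax K hK) (not_le.2 hlt.1)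
  intro n
  induction n with
  | zero => intro J hJ hJh; exact step hJ h1 hJh
  | succ n ih =>
    intro J hJ hJh
    obtain ⟨I, hI, hIJ, hIh⟩ := step (m := h + 1 + n) hJ (by omega) (by omega)
    obtain ⟨I', hI', hII', h'⟩ := ih hI hIh
    exact ⟨I', hI', hII'.trans hIJ, h'⟩

theorem exists_precedes_of_lt_height {T : Finset (ℝ × ℝ)} {h : ℕ} {J : ℝ × ℝ} (h1 : 1 ≤ h)
    (hJ : J ∈ T) (hlt : h < height T J) : ∃ I ∈ T, Precedes I J ∧ height T I = h :=
  exists_precedes_height_eq h1 (height T J - h - 1) hJ (by omega)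

/-- Intervals through a common point form a clique as soon as they form a chain. -/
theorem height_le_cliqueNumber {T : Finset (ℝ × ℝ)} {p : ℝ}
    (hp : ∀ I ∈ T, p ∈ Ioo I.1 I.2) {I : ℝ × ℝ} (hI : I ∈ T) :
    height T I ≤ cliqueNumber T := by
  obtain ⟨U, hU, -, hc, -, hcard⟩ := exists_chain_card_eq_height hI
  rw [← hcard]
  refine card_le_cliqueNumber hU fun J hJ K hK hne => ?_
  have hJp := hp J (hU hJ)
  have hKp := hp K (hU hK)
  rcases hc hJ hK hne with h | h
  · exact h.overlap (hKp.1.trans hJp.2)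
  · exact (h.overlap (hJp.1.trans hKp.2)).symm

/-! ### The colours available at a pillar -/

theorem infinite_available (X : Finset ℕ) : {c | 0 < c ∧ c ∉ X}.Infinite := by
  have : {c | 0 < c ∧ c ∉ X} = ((insert 0 X : Finset ℕ) : Set ℕ)ᶜ := by
    ext c; simp [Nat.pos_iff_ne_zero]
  rw [this]
  exact (Finset.finite_toSet _).infinite_compl

theorem card_smallestColours (X : Finset ℕ) (w : ℕ) : (smallestColours X w).card = w := by
  unfold smallestColours
  rw [Finset.card_image_of_injective _ (Nat.nth_injective (infinite_available X)),
    Finset.card_range]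

theorem pos_of_mem_smallestColours {X : Finset ℕ} {w c : ℕ} (h : c ∈ smallestColours X w) :
    0 < c ∧ c ∉ X := by
  obtain ⟨i, -, rfl⟩ := Finset.mem_image.1 h
  exact Nat.nth_mem_of_infinite (infinite_available X) i

theorem le_of_mem_smallestColours {X : Finset ℕ} {w c : ℕ} (h : c ∈ smallestColours X w) :
    c ≤ X.card + w := by
  classical
  obtain ⟨i, hi, rfl⟩ := Finset.mem_image.1 h
  rw [Finset.mem_range] at hi
  set n := Nat.nth (fun c => 0 < c ∧ c ∉ X) i with hn
  -- there are only `i` available colours below the `i`-th one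
  have hcount : Nat.count (fun c => 0 < c ∧ c ∉ X) n = i :=
    Nat.count_nth_of_infinite (infinite_available X) i
  rw [Nat.count_eq_card_filter_range] at hcount
  have hsub : Finset.range n ⊆
      insert 0 X ∪ (Finset.range n).filter (fun c => 0 < c ∧ c ∉ X) := by
    intro c hc
    simp only [Finset.mem_union, Finset.mem_insert, Finset.mem_filter]
    by_cases h0 : c = 0
    · simp [h0]
    · by_cases hX : c ∈ X
      · simp [hX]
      · exact Or.inr ⟨hc, Nat.pos_of_ne_zero h0, hX⟩
  have h1 := (Finset.card_le_card hsub).trans (Finset.card_union_le _ _)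
  have h2 := Finset.card_insert_le 0 X
  rw [Finset.card_range, hcount] at h1
  omega

theorem mem_smallestColours_of_lt {X : Finset ℕ} {w c d : ℕ} (h : c ∈ smallestColours X w)
    (hd : 0 < d) (hdX : d ∉ X) (hdc : d < c) : d ∈ smallestColours X w := by
  classical
  obtain ⟨i, hi, rfl⟩ := Finset.mem_image.1 h
  rw [Finset.mem_range] at hi
  refine Finset.mem_image.2 ⟨Nat.count (fun c => 0 < c ∧ c ∉ X) d, ?_, ?_⟩
  · rw [Finset.mem_range]
    refine lt_of_le_of_lt ?_ hi
    rw [← Nat.count_nth_of_infinite (infinite_available X) i]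
    exact Nat.count_monotone _ hdc.le
  · exact Nat.nth_count (p := fun c => 0 < c ∧ c ∉ X) ⟨hd, hdX⟩

section permutationColouring

variable {T : Finset (ℝ × ℝ)} {C : Finset ℕ} {I J : ℝ × ℝ}

theorem setOf_mem_finite (C : Finset ℕ) : {c | c ∈ C}.Finite := C.finite_toSet

theorem permutationColouring_mem (hI : I ∈ T) (h : height T I ≤ C.card) :
    permutationColouring T C I ∈ C := by
  have := one_le_height hI
  refine Nat.nth_mem_of_lt_card (p := fun c => c ∈ C) (setOf_mem_finite C) ?_
  rw [show (setOf_mem_finite C).toFinset = C by ext; simp]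
  omega

theorem height_eq_of_permutationColouring_eq (hI : I ∈ T) (hJ : J ∈ T)
    (h : height T I ≤ C.card) (h' : height T J ≤ C.card)
    (heq : permutationColouring T C I = permutationColouring T C J) :
    height T I = height T J := by
  have h1 := one_le_height hI
  have h2 := one_le_height hJ
  have hC : (setOf_mem_finite C).toFinset = C := by ext; simp
  have := Nat.nth_injOn (p := fun c => c ∈ C) (setOf_mem_finite C)
    (by rw [hC]; simp; omega) (by rw [hC]; simp; omega) heq
  omega

/-- The colours used by a permutation colouring form an initial segment of the palette. -/
theorem exists_permutationColouring_eq {d : ℕ} (hI : I ∈ T)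
    (hd : d ∈ C) (hlt : d < permutationColouring T C I) :
    ∃ J ∈ T, permutationColouring T C J = d := by
  classical
  have h1 := one_le_height hI
  have hcount : Nat.count (fun c => c ∈ C) d < height T I - 1 := by
    by_contra! hle
    have h2 : (Nat.count (fun c => c ∈ C) d) < (setOf_mem_finite C).toFinset.card :=
      Nat.count_lt_card (setOf_mem_finite C) hd
    have := Nat.nth_le_nth_of_lt_card (p := fun c => c ∈ C) (setOf_mem_finite C) hle h2
    rw [Nat.nth_count (p := fun c => c ∈ C) hd] at this
    exact absurd hlt (not_lt.2 this)
  obtain ⟨J, hJ, -, hJh⟩ := exists_precedes_of_lt_height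
    (h := Nat.count (fun c => c ∈ C) d + 1) (by omega) hI (by omega)
  refine ⟨J, hJ, ?_⟩
  rw [permutationColouring, hJh, Nat.add_sub_cancel]
  exact Nat.nth_count (p := fun c => c ∈ C) hd

end permutationColouring

/-! ### The colouring given by a list of pillars -/

namespace IntervalSystem

variable {S : IntervalSystem} {l : List ℝ} {p : ℝ} {I J : ℝ × ℝ}

theorem mem_assigned : I ∈ S.assigned l p ↔
    I ∈ S.intervals ∧ p ∈ Ioo I.1 I.2 ∧ ∀ q ∈ l, q ∉ Ioo I.1 I.2 := by
  classical
  simp [assigned]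

theorem mem_oneEndpointIn {F : Set ℝ} : I ∈ S.oneEndpointIn F ↔
    I ∈ S.intervals ∧ ((I.1 ∈ F ∧ I.2 ∉ F) ∨ (I.1 ∉ F ∧ I.2 ∈ F)) := by
  classical
  simp [oneEndpointIn]

/-- The palette of the pillar `p`, added after the pillars of `l`. -/
noncomputable def palette (S : IntervalSystem) (l : List ℝ) (p : ℝ) : Finset ℕ :=
  smallestColours (coloursUsed (S.colouringRev l) (S.oneEndpointIn (foundation l p)))
    (cliqueNumber (S.assigned l p))

theorem colouringRev_cons_of_mem (h : I ∈ S.assigned l p) :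
    S.colouringRev (p :: l) I =
      some (permutationColouring (S.assigned l p) (S.palette l p) I) := by
  classical
  simp [colouringRev, h, palette]

theorem colouringRev_cons_of_notMem (h : I ∉ S.assigned l p) :
    S.colouringRev (p :: l) I = S.colouringRev l I := by
  classical
  simp [colouringRev, h]

theorem height_le_card_palette (h : I ∈ S.assigned l p) :
    height (S.assigned l p) I ≤ (S.palette l p).card := by
  rw [palette, card_smallestColours]
  exact height_le_cliqueNumber (fun K hK => (mem_assigned.1 hK).2.1) h

theorem permutationColouring_mem_palette (h : I ∈ S.assigned l p) :
    permutationColouring (S.assigned l p) (S.palette l p) I ∈ S.palette l p :=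
  permutationColouring_mem h (height_le_card_palette h)

/-- The coloured intervals are those that contain a pillar. -/
theorem colouringRev_ne_none_iff :
    S.colouringRev l I ≠ none ↔ I ∈ S.intervals ∧ ∃ q ∈ l, q ∈ Ioo I.1 I.2 := by
  induction l with
  | nil => simp [colouringRev]
  | cons p l ih =>
    by_cases h : I ∈ S.assigned l p
    · have h' := mem_assigned.1 h
      simp only [colouringRev_cons_of_mem h, ne_eq, reduceCtorEq, not_false_eq_true, true_iff]
      exact ⟨h'.1, p, by simp, h'.2.1⟩
    · rw [colouringRev_cons_of_notMem h, ih]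
      refine and_congr_right fun hI => ⟨fun ⟨q, hq, hqI⟩ => ⟨q, by simp [hq], hqI⟩, ?_⟩
      rintro ⟨q, hq, hqI⟩
      by_contra! hc
      rcases List.mem_cons.1 hq with rfl | hq
      · exact h (mem_assigned.2 ⟨hI, hqI, hc⟩)
      · exact hc q hq hqI

theorem colouringRev_cons_of_ne_none (h : S.colouringRev l I ≠ none) :
    S.colouringRev (p :: l) I = S.colouringRev l I := by
  refine colouringRev_cons_of_notMem fun h' => ?_
  obtain ⟨-, q, hq, hqI⟩ := colouringRev_ne_none_iff.1 h
  exact (mem_assigned.1 h').2.2 q hq hqI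

theorem colouringRev_append (l' : List ℝ) (h : S.colouringRev l I ≠ none) :
    S.colouringRev (l' ++ l) I = S.colouringRev l I := by
  induction l' with
  | nil => rfl
  | cons p l' ih =>
    rw [List.cons_append, colouringRev_cons_of_ne_none (by rwa [ih]), ih]

/-- The foundation of `p` is the arch of the earlier pillars that contains `p`. -/
theorem exists_foundation_eq (hp : p ∈ Ioo (0 : ℝ) 1) (hpl : p ∉ l) :
    ∃ a b, foundation l p = Ioo a b ∧ a < p ∧ p < b ∧ (a = 0 ∨ a ∈ l) ∧ (b = 1 ∨ b ∈ l) ∧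
      ∀ q ∈ l, q ∉ Ioo a b := by
  classical
  have hmax : ∀ (L : List ℝ) (z : ℝ), (L.foldr max z = z ∨ L.foldr max z ∈ L) ∧
      ∀ q ∈ L, q ≤ L.foldr max z := by
    intro L z
    induction L with
    | nil => simp
    | cons x L ih =>
      simp only [List.foldr_cons, List.mem_cons, forall_eq_or_imp]
      refine ⟨?_, le_max_left _ _, fun q hq => (ih.2 q hq).trans (le_max_right _ _)⟩
      rcases max_choice x (L.foldr max z) with h | h <;> rw [h]
      · simp
      · tauto
  have hmin : ∀ (L : List ℝ) (z : ℝ), (L.foldr min z = z ∨ L.foldr min z ∈ L) ∧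
      ∀ q ∈ L, L.foldr min z ≤ q := by
    intro L z
    induction L with
    | nil => simp
    | cons x L ih =>
      simp only [List.foldr_cons, List.mem_cons, forall_eq_or_imp]
      refine ⟨?_, min_le_left _ _, fun q hq => (min_le_right _ _).trans (ih.2 q hq)⟩
      rcases min_choice x (L.foldr min z) with h | h <;> rw [h]
      · simp
      · tauto
  obtain ⟨h1, h2⟩ := hmax (l.filter fun q => q < p) 0
  obtain ⟨h3, h4⟩ := hmin (l.filter fun q => p < q) 1
  refine ⟨_, _, rfl, ?_, ?_, ?_, ?_, ?_⟩
  · rcases h1 with h | h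
    · rw [h]; exact hp.1
    · simpa using (List.mem_filter.1 h).2
  · rcases h3 with h | h
    · rw [h]; exact hp.2
    · simpa using (List.mem_filter.1 h).2
  · exact h1.imp id fun h => (List.mem_filter.1 h).1
  · exact h3.imp id fun h => (List.mem_filter.1 h).1
  · rintro q hq ⟨hq1, hq2⟩
    rcases lt_trichotomy q p with h | rfl | h
    · exact absurd (h2 q (List.mem_filter.2 ⟨hq, by simpa using h⟩)) (not_le.2 hq1)
    · exact hpl hq
    · exact absurd (h4 q (List.mem_filter.2 ⟨hq, by simpa using h⟩)) (not_le.2 hq2)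

/-- An interval assigned to `p` lies in the foundation of `p`, up to its endpoints. -/
theorem bounds_of_mem_assigned {a b : ℝ} (h : I ∈ S.assigned l p) (hap : a < p) (hpb : p < b)
    (ha : a = 0 ∨ a ∈ l) (hb : b = 1 ∨ b ∈ l) : a ≤ I.1 ∧ I.2 ≤ b := by
  obtain ⟨hI, hpI, hno⟩ := mem_assigned.1 h
  constructor
  · rcases ha with rfl | ha
    · exact S.nonneg I hI
    · by_contra! hc
      exact hno a ha ⟨hc, hap.trans hpI.2⟩
  · rcases hb with rfl | hb
    · exact S.le_one I hI
    · by_contra! hc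
      exact hno b hb ⟨hpI.1.trans hpb, hc⟩

/-- A coloured interval with an endpoint in an arch has exactly one endpoint there. -/
theorem mem_oneEndpointIn_of_ne_none {a b : ℝ} (hab : ∀ q ∈ l, q ∉ Ioo a b)
    (h : S.colouringRev l I ≠ none) (hI : I.1 ∈ Ioo a b ∨ I.2 ∈ Ioo a b) :
    I ∈ S.oneEndpointIn (Ioo a b) := by
  obtain ⟨hIS, q, hq, hqI⟩ := colouringRev_ne_none_iff.1 h
  have hqab := hab q hq
  refine mem_oneEndpointIn.2 ⟨hIS, ?_⟩
  by_contra hc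
  have : I.1 ∈ Ioo a b ∧ I.2 ∈ Ioo a b := by tauto
  exact hqab ⟨this.1.1.trans hqI.1, hqI.2.trans this.2.2⟩

/-- An interval assigned to the new pillar gets a colour that differs from that of any earlier
interval with an endpoint in the foundation. -/
theorem permutationColouring_ne {a b : ℝ} (hF : foundation l p = Ioo a b)
    (hab : ∀ q ∈ l, q ∉ Ioo a b) (hI : I ∈ S.assigned l p)
    (hJ : J.1 ∈ Ioo a b ∨ J.2 ∈ Ioo a b) :
    S.colouringRev l J ≠ some (permutationColouring (S.assigned l p) (S.palette l p) I) := by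
  intro h
  refine (pos_of_mem_smallestColours (permutationColouring_mem_palette hI)).2 ?_
  refine mem_coloursUsed.2 ⟨J, ?_, h⟩
  rw [hF]
  exact mem_oneEndpointIn_of_ne_none hab (by simp [h]) hJ

/-- The colouring given by any list of pillars is proper: at a new pillar, overlapping intervals
have different heights, and earlier intervals overlapping a new one have exactly one endpoint in
the foundation. -/
theorem isProperPartialColouring_colouringRev (hl : l.Nodup) (hp : ∀ p ∈ l, S.IsPillar p) :
    S.IsProperPartialColouring (S.colouringRev l) := by
  induction l with
  | nil => intro I _ J _ _ c h; simp [colouringRev] at h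
  | cons p l ih =>
    have ih := ih (List.nodup_cons.1 hl).2 fun q hq => hp q (by simp [hq])
    obtain ⟨a, b, hF, hap, hpb, ha, hb, hab⟩ :=
      exists_foundation_eq (hp p (by simp)).1 (List.nodup_cons.1 hl).1
    -- the case of a new interval `I` and an earlier interval `J`
    have key : ∀ I ∈ S.assigned l p, ∀ J, Overlap I J → S.colouringRev l J ≠
        some (permutationColouring (S.assigned l p) (S.palette l p) I) := by
      intro I hI J hIJ
      refine permutationColouring_ne hF hab hI ?_
      have hbd := bounds_of_mem_assigned hI hap hpb ha hb
      obtain ⟨y, hyI, hyJ⟩ := hIJ.1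
      rcases hIJ.precedes_or_precedes with h | h
      · exact Or.inl ⟨hbd.1.trans_lt h.1, (hyJ.1.trans hyI.2).trans_le hbd.2⟩
      · exact Or.inr ⟨hbd.1.trans_lt (hyI.1.trans hyJ.2), h.2.trans_le hbd.2⟩
    intro I hI J hJ hIJ c hc hc'
    by_cases h1 : I ∈ S.assigned l p <;> by_cases h2 : J ∈ S.assigned l p
    · rw [colouringRev_cons_of_mem h1, Option.some_inj] at hc
      rw [colouringRev_cons_of_mem h2, Option.some_inj] at hc'
      have := height_eq_of_permutationColouring_eq h1 h2 (height_le_card_palette h1)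
        (height_le_card_palette h2) (hc.trans hc'.symm)
      rcases hIJ.precedes_or_precedes with h | h
      · exact (height_lt_height h1 h2 h).ne this
      · exact (height_lt_height h2 h1 h).ne this.symm
    · rw [colouringRev_cons_of_mem h1] at hc
      rw [colouringRev_cons_of_notMem h2] at hc'
      exact key I h1 J hIJ (hc'.trans hc.symm)
    · rw [colouringRev_cons_of_notMem h1] at hc
      rw [colouringRev_cons_of_mem h2] at hc'
      exact key J h2 I hIJ.symm (hc.trans hc'.symm)
    · rw [colouringRev_cons_of_notMem h1] at hc
      rw [colouringRev_cons_of_notMem h2] at hc'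
      exact ih I hI J hJ hIJ c hc hc'

theorem pos_of_colouringRev_eq_some {c : ℕ} (h : S.colouringRev l I = some c) : 0 < c := by
  induction l with
  | nil => simp [colouringRev] at h
  | cons p l ih =>
    by_cases hI : I ∈ S.assigned l p
    · rw [colouringRev_cons_of_mem hI, Option.some_inj] at h
      rw [← h]
      exact (pos_of_mem_smallestColours (permutationColouring_mem_palette hI)).1
    · rw [colouringRev_cons_of_notMem hI] at h
      exact ih h

/-- The colours used form an initial segment of the positive integers. -/
theorem exists_colouringRev_eq_of_lt {c d : ℕ} (h : S.colouringRev l I = some c) (hd : 0 < d)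
    (hdc : d < c) : ∃ J, S.colouringRev l J = some d := by
  induction l generalizing I c with
  | nil => simp [colouringRev] at h
  | cons p l ih =>
    -- colours used before stay in use
    have keep : (∃ J, S.colouringRev l J = some d) →
        ∃ J, S.colouringRev (p :: l) J = some d := by
      rintro ⟨J, hJ⟩
      exact ⟨J, by rw [colouringRev_cons_of_ne_none (by simp [hJ]), hJ]⟩
    by_cases hI : I ∈ S.assigned l p
    · rw [colouringRev_cons_of_mem hI, Option.some_inj] at h
      by_cases hX : d ∈ coloursUsed (S.colouringRev l) (S.oneEndpointIn (foundation l p))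
      · obtain ⟨J, -, hJ⟩ := mem_coloursUsed.1 hX
        exact keep ⟨J, hJ⟩
      · have hdC : d ∈ S.palette l p :=
          mem_smallestColours_of_lt (permutationColouring_mem_palette hI) hd hX (h ▸ hdc)
        obtain ⟨J, hJ, hJd⟩ := exists_permutationColouring_eq hI hdC (h ▸ hdc)
        exact ⟨J, by rw [colouringRev_cons_of_mem hJ, hJd]⟩
    · rw [colouringRev_cons_of_notMem hI] at h
      exact keep (ih h hdc)

/-! ### Labels: the pillar and the height of a coloured interval -/

open scoped Classical in
/-- The label of a coloured interval: the pillar to which it is assigned, and its height among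
the intervals assigned to that pillar. Pillars are listed from the last one to the first one;
uncoloured intervals get the junk label `(0, 0)`. -/
noncomputable def label (S : IntervalSystem) : List ℝ → ℝ × ℝ → ℝ × ℕ
  | [], _ => (0, 0)
  | p :: l, I => if I ∈ S.assigned l p then (p, height (S.assigned l p) I) else label S l I

theorem label_cons_of_mem (h : I ∈ S.assigned l p) :
    S.label (p :: l) I = (p, height (S.assigned l p) I) := by
  simp [label, h]

theorem label_cons_of_notMem (h : I ∉ S.assigned l p) : S.label (p :: l) I = S.label l I := by
  simp [label, h]

theorem label_spec (h : S.colouringRev l I ≠ none) :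
    (S.label l I).1 ∈ l ∧ (S.label l I).1 ∈ Ioo I.1 I.2 ∧ 1 ≤ (S.label l I).2 := by
  induction l with
  | nil => simp [colouringRev] at h
  | cons p l ih =>
    by_cases hI : I ∈ S.assigned l p
    · rw [label_cons_of_mem hI]
      exact ⟨by simp, (mem_assigned.1 hI).2.1, one_le_height hI⟩
    · rw [colouringRev_cons_of_notMem hI] at h
      rw [label_cons_of_notMem hI]
      exact ⟨List.mem_cons_of_mem _ (ih h).1, (ih h).2⟩

theorem label_fst_ne (hpl : p ∉ l) (h : S.colouringRev l I ≠ none) : (S.label l I).1 ≠ p :=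
  fun h' => hpl (h' ▸ (label_spec h).1)

theorem colouringRev_eq_of_label_eq (hl : l.Nodup) (hI : S.colouringRev l I ≠ none)
    (hJ : S.colouringRev l J ≠ none) (h : S.label l I = S.label l J) :
    S.colouringRev l I = S.colouringRev l J := by
  induction l with
  | nil => rfl
  | cons p l ih =>
    have hpl := (List.nodup_cons.1 hl).1
    by_cases h1 : I ∈ S.assigned l p <;> by_cases h2 : J ∈ S.assigned l p
    · rw [label_cons_of_mem h1, label_cons_of_mem h2, Prod.mk.injEq] at h
      rw [colouringRev_cons_of_mem h1, colouringRev_cons_of_mem h2, permutationColouring,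
        permutationColouring, h.2]
    · rw [colouringRev_cons_of_notMem h2] at hJ
      rw [label_cons_of_mem h1, label_cons_of_notMem h2] at h
      exact absurd (congrArg Prod.fst h).symm (label_fst_ne hpl hJ)
    · rw [colouringRev_cons_of_notMem h1] at hI
      rw [label_cons_of_notMem h1, label_cons_of_mem h2] at h
      exact absurd (congrArg Prod.fst h) (label_fst_ne hpl hI)
    · rw [colouringRev_cons_of_notMem h1] at hI ⊢
      rw [colouringRev_cons_of_notMem h2] at hJ ⊢
      rw [label_cons_of_notMem h1, label_cons_of_notMem h2] at h
      exact ih (List.nodup_cons.1 hl).2 hI hJ h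

/-- Among the coloured intervals with an endpoint in a fixed arch, the colour determines the
label: the foundation of the later of two pillars contains the whole arch, so its palette avoids
the colour of the interval assigned to the earlier one. -/
theorem label_eq_of_colouringRev_eq (hl : l.Nodup) (hp : ∀ p ∈ l, S.IsPillar p) {a b : ℝ}
    (h0 : 0 ≤ a) (h1 : b ≤ 1) (hab : ∀ q ∈ l, q ∉ Ioo a b) (hI : S.colouringRev l I ≠ none)
    (hIK : I.1 ∈ Ioo a b ∨ I.2 ∈ Ioo a b) (hJK : J.1 ∈ Ioo a b ∨ J.2 ∈ Ioo a b)
    (h : S.colouringRev l I = S.colouringRev l J) : S.label l I = S.label l J := by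
  induction l with
  | nil => rfl
  | cons p l ih =>
    have hpl := (List.nodup_cons.1 hl).1
    obtain ⟨a', b', hF, hap, hpb, ha, hb, hab'⟩ := exists_foundation_eq (hp p (by simp)).1 hpl
    have hab₁ : ∀ q ∈ l, q ∉ Ioo a b := fun q hq => hab q (by simp [hq])
    have key : ∀ I ∈ S.assigned l p, (I.1 ∈ Ioo a b ∨ I.2 ∈ Ioo a b) →
        ∀ J, (J.1 ∈ Ioo a b ∨ J.2 ∈ Ioo a b) → S.colouringRev l J ≠
          some (permutationColouring (S.assigned l p) (S.palette l p) I) := by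
      intro I hI hIK J hJK
      have hbd := bounds_of_mem_assigned hI hap hpb ha hb
      have hlt := S.lt I (mem_assigned.1 hI).1
      have ha' : a' ≤ a := by
        rcases ha with rfl | ha
        · exact h0
        · by_contra! hc
          refine hab₁ a' ha ⟨hc, ?_⟩
          rcases hIK with h | h <;> linarith [h.2]
      have hb' : b ≤ b' := by
        rcases hb with rfl | hb
        · exact h1
        · by_contra! hc
          refine hab₁ b' hb ⟨?_, hc⟩
          rcases hIK with h | h <;> linarith [h.1]
      exact permutationColouring_ne hF hab' hI
        (hJK.imp (fun h => Ioo_subset_Ioo ha' hb' h) fun h => Ioo_subset_Ioo ha' hb' h)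
    by_cases h1 : I ∈ S.assigned l p <;> by_cases h2 : J ∈ S.assigned l p
    · rw [colouringRev_cons_of_mem h1, colouringRev_cons_of_mem h2, Option.some_inj] at h
      rw [label_cons_of_mem h1, label_cons_of_mem h2,
        height_eq_of_permutationColouring_eq h1 h2 (height_le_card_palette h1)
          (height_le_card_palette h2) h]
    · rw [colouringRev_cons_of_mem h1, colouringRev_cons_of_notMem h2] at h
      exact absurd h.symm (key I h1 hIK J hJK)
    · rw [colouringRev_cons_of_notMem h1, colouringRev_cons_of_mem h2] at h
      exact absurd h (key J h2 hJK I hIK)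
    · rw [colouringRev_cons_of_notMem h1] at h hI
      rw [colouringRev_cons_of_notMem h2] at h
      rw [label_cons_of_notMem h1, label_cons_of_notMem h2]
      exact ih (List.nodup_cons.1 hl).2 (fun q hq => hp q (by simp [hq])) hab₁ hI h

/-- Of two intervals assigned to different pillars, one does not contain the pillar of the
other, namely the pillar that comes first. -/
theorem label_notMem_or (hl : l.Nodup) (hI : S.colouringRev l I ≠ none)
    (hJ : S.colouringRev l J ≠ none) (h : (S.label l I).1 ≠ (S.label l J).1) :
    (S.label l I).1 ∉ Ioo J.1 J.2 ∨ (S.label l J).1 ∉ Ioo I.1 I.2 := by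
  induction l with
  | nil => simp [label] at h
  | cons p l ih =>
    by_cases h1 : I ∈ S.assigned l p <;> by_cases h2 : J ∈ S.assigned l p
    · simp [label_cons_of_mem h1, label_cons_of_mem h2] at h
    · rw [colouringRev_cons_of_notMem h2] at hJ
      rw [label_cons_of_notMem h2]
      exact Or.inr ((mem_assigned.1 h1).2.2 _ (label_spec hJ).1)
    · rw [colouringRev_cons_of_notMem h1] at hI
      rw [label_cons_of_notMem h1]
      exact Or.inl ((mem_assigned.1 h2).2.2 _ (label_spec hI).1)
    · rw [colouringRev_cons_of_notMem h1] at hI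
      rw [colouringRev_cons_of_notMem h2] at hJ
      rw [label_cons_of_notMem h1, label_cons_of_notMem h2] at h ⊢
      exact ih (List.nodup_cons.1 hl).2 hI hJ h

theorem label_snd_lt_of_precedes (hl : l.Nodup) (hI : S.colouringRev l I ≠ none)
    (hJ : S.colouringRev l J ≠ none) (h : (S.label l I).1 = (S.label l J).1)
    (hIJ : Precedes I J) : (S.label l I).2 < (S.label l J).2 := by
  induction l with
  | nil => simp [colouringRev] at hI
  | cons p l ih =>
    have hpl := (List.nodup_cons.1 hl).1
    by_cases h1 : I ∈ S.assigned l p <;> by_cases h2 : J ∈ S.assigned l p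
    · rw [label_cons_of_mem h1, label_cons_of_mem h2]
      exact height_lt_height h1 h2 hIJ
    · rw [colouringRev_cons_of_notMem h2] at hJ
      rw [label_cons_of_mem h1, label_cons_of_notMem h2] at h
      exact absurd h.symm (label_fst_ne hpl hJ)
    · rw [colouringRev_cons_of_notMem h1] at hI
      rw [label_cons_of_notMem h1, label_cons_of_mem h2] at h
      exact absurd h (label_fst_ne hpl hI)
    · rw [colouringRev_cons_of_notMem h1] at hI
      rw [colouringRev_cons_of_notMem h2] at hJ
      rw [label_cons_of_notMem h1, label_cons_of_notMem h2] at h ⊢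
      exact ih (List.nodup_cons.1 hl).2 hI hJ h

theorem exists_precedes_label_eq {h : ℕ} (h1 : 1 ≤ h) (hJ : S.colouringRev l J ≠ none)
    (hlt : h < (S.label l J).2) :
    ∃ I, S.colouringRev l I ≠ none ∧ Precedes I J ∧ S.label l I = ((S.label l J).1, h) := by
  induction l with
  | nil => simp [colouringRev] at hJ
  | cons p l ih =>
    by_cases h2 : J ∈ S.assigned l p
    · rw [label_cons_of_mem h2] at hlt ⊢
      obtain ⟨I, hI, hIJ, hIh⟩ := exists_precedes_of_lt_height h1 h2 hlt
      exact ⟨I, by simp [colouringRev_cons_of_mem hI], hIJ, by rw [label_cons_of_mem hI, hIh]⟩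
    · rw [colouringRev_cons_of_notMem h2] at hJ
      rw [label_cons_of_notMem h2] at hlt ⊢
      obtain ⟨I, hI, hIJ, hIh⟩ := ih hJ hlt
      refine ⟨I, by rwa [colouringRev_cons_of_ne_none hI], hIJ, ?_⟩
      rw [label_cons_of_notMem, hIh]
      intro h'
      obtain ⟨-, q, hq, hqI⟩ := colouringRev_ne_none_iff.1 hI
      exact (mem_assigned.1 h').2.2 q hq hqI

end IntervalSystem

/-! ### Cutting a sequence into pieces with few colours -/

/-- In a `13 × 8` grid, any `55` cells contain four whose rows and columns both increase strictly:
each of the `20` diagonals is such a sequence, and the corner diagonals have lengths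
`1, 1, 2, 2`, so cells with at most three on each diagonal number at most
`3 * 16 + 1 + 1 + 2 + 2 = 54`. -/
theorem exists_increasing_cells {R : Finset (ℕ × ℕ)}
    (hR : R ⊆ Finset.range 13 ×ˢ Finset.range 8) (hcard : 54 < R.card) :
    ∃ f : Fin 4 → ℕ × ℕ, (∀ i, f i ∈ R) ∧ StrictMono (fun i => (f i).1) ∧
      StrictMono (fun i => (f i).2) := by
  have hmem : ∀ x ∈ R, x.1 < 13 ∧ x.2 < 8 := fun x hx => by simpa using hR hx
  obtain ⟨d, -, hd⟩ : ∃ d ∈ Finset.range 20, 3 < (R.filter fun x => x.1 + 7 - x.2 = d).card := by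
    by_contra! hc
    have h1 : R.card = ∑ d ∈ Finset.range 20, (R.filter fun x => x.1 + 7 - x.2 = d).card :=
      Finset.card_eq_sum_card_fiberwise fun x hx => by
        have := hmem x hx
        simp only [Finset.coe_range, mem_Iio]; omega
    have h2 : ∑ d ∈ Finset.range 20, (R.filter fun x => x.1 + 7 - x.2 = d).card ≤
        ∑ d ∈ Finset.range 20, min 3 ((Finset.range 13 ×ˢ Finset.range 8).filter
          fun x : ℕ × ℕ => x.1 + 7 - x.2 = d).card :=
      Finset.sum_le_sum fun d hd => le_min (hc d hd)
        (Finset.card_le_card (Finset.filter_subset_filter _ hR))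
    have h3 : ∑ d ∈ Finset.range 20, min 3 ((Finset.range 13 ×ˢ Finset.range 8).filter
          fun x : ℕ × ℕ => x.1 + 7 - x.2 = d).card = 54 := by decide +kernel
    omega
  set D := R.filter fun x => x.1 + 7 - x.2 = d with hD
  have hDmem : ∀ x ∈ D, x ∈ R ∧ x.1 + 7 - x.2 = d := fun x hx => by simpa [hD] using hx
  have hinj : Set.InjOn Prod.fst (D : Set (ℕ × ℕ)) := by
    intro x hx y hy hxy
    obtain ⟨hx, hx'⟩ := hDmem x hx
    obtain ⟨hy, hy'⟩ := hDmem y hy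
    have := hmem x hx
    have := hmem y hy
    refine Prod.ext hxy ?_
    omega
  have hc4 : 4 ≤ (D.image Prod.fst).card := by
    rw [Finset.card_image_of_injOn hinj]; omega
  set e := Finset.orderEmbOfCardLe (D.image Prod.fst) hc4
  have he : ∀ i, ∃ x ∈ D, x.1 = e i := fun i =>
    Finset.mem_image.1 (Finset.orderEmbOfCardLe_mem (D.image Prod.fst) hc4 i)
  choose f hf hfe using he
  have hlt : ∀ i j, i < j → (f i).1 < (f j).1 := fun i j hij => by
    rw [hfe, hfe]; exact e.strictMono hij
  refine ⟨f, fun i => (hDmem _ (hf i)).1, fun i j hij => hlt i j hij, fun i j hij => ?_⟩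
  have h1 := hDmem _ (hf i)
  have h2 := hDmem _ (hf j)
  have := hmem _ h1.1
  have := hmem _ h2.1
  have := hlt i j hij
  dsimp only
  omega

/-- If a sequence with at most `13` rows has eight pieces with at least seven rows each, then it
has four elements that increase strictly both in the order of the rows and in that of the
pieces. -/
theorem exists_increasing_of_pieces {β α : Type*} [LinearOrder α] {E : Finset β} {row : β → α}
    {piece : β → ℕ} (hrow : (E.image row).card ≤ 13)
    (h : ∀ i < 8, 7 ≤ ((E.filter fun e => piece e = i).image row).card) :
    ∃ e : Fin 4 → β, (∀ i, e i ∈ E) ∧ StrictMono (fun i => row (e i)) ∧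
      StrictMono (fun i => piece (e i)) := by
  classical
  set rank : α → ℕ := fun x => ((E.image row).filter (· < x)).card with hrank
  have hrank_lt : ∀ x ∈ E.image row, ∀ y, x < y → rank x < rank y := by
    intro x hx y hxy
    refine Finset.card_lt_card (Finset.ssubset_iff_of_subset ?_ |>.2 ⟨x, ?_, ?_⟩)
    · intro z hz
      rw [Finset.mem_filter] at hz ⊢
      exact ⟨hz.1, hz.2.trans hxy⟩
    · exact Finset.mem_filter.2 ⟨hx, hxy⟩
    · simp
  have hrank_inj : Set.InjOn rank (E.image row : Set α) := by
    intro x hx y hy hxy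
    rcases lt_trichotomy x y with h | h | h
    · exact absurd hxy (hrank_lt x hx y h).ne
    · exact h
    · exact absurd hxy (hrank_lt y hy x h).ne'
  have hrank_bd : ∀ x ∈ E.image row, rank x < 13 := by
    intro x hx
    refine lt_of_lt_of_le (Finset.card_lt_card
      (Finset.ssubset_iff_of_subset (Finset.filter_subset _ _) |>.2 ⟨x, hx, ?_⟩)) hrow
    simp
  set R := (E.filter fun e => piece e < 8).image fun e => (rank (row e), piece e) with hRdef
  have hR : R ⊆ Finset.range 13 ×ˢ Finset.range 8 := by
    intro x hx
    obtain ⟨e, he, rfl⟩ := Finset.mem_image.1 hx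
    rw [Finset.mem_filter] at he
    simp only [Finset.mem_product, Finset.mem_range]
    exact ⟨hrank_bd _ (Finset.mem_image_of_mem _ he.1), he.2⟩
  have hcard : 54 < R.card := by
    have h1 : R.card = ∑ i ∈ Finset.range 8, (R.filter fun x => x.2 = i).card :=
      Finset.card_eq_sum_card_fiberwise fun x hx => by
        have := hR hx
        simp only [Finset.mem_product] at this
        exact this.2
    have h2 : ∑ i ∈ Finset.range 8, 7 ≤ ∑ i ∈ Finset.range 8, (R.filter fun x => x.2 = i).card := by
      refine Finset.sum_le_sum fun i hi => ?_
      rw [Finset.mem_range] at hi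
      have h3 := h i hi
      rw [← Finset.card_image_of_injOn (f := rank) (hrank_inj.mono (by
        exact_mod_cast Finset.image_subset_image (Finset.filter_subset _ _)))] at h3
      rw [← Finset.card_image_of_injective (f := fun r : ℕ => (r, i)) _
        (fun _ _ h => (Prod.mk.inj h).1)] at h3
      refine h3.trans (Finset.card_le_card ?_)
      intro x hx
      simp only [Finset.mem_image, Finset.mem_filter, exists_exists_and_eq_and] at hx
      obtain ⟨e, he, rfl⟩ := hx
      refine Finset.mem_filter.2 ⟨Finset.mem_image.2 ⟨e, ?_, by rw [he.2]⟩, rfl⟩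
      exact Finset.mem_filter.2 ⟨he.1, by omega⟩
    simp only [Finset.sum_const, Finset.card_range, smul_eq_mul] at h2
    omega
  obtain ⟨f, hf, hf1, hf2⟩ := exists_increasing_cells hR hcard
  have : ∀ i, ∃ e ∈ E, (rank (row e), piece e) = f i := fun i => by
    obtain ⟨e, he, h⟩ := Finset.mem_image.1 (hf i)
    exact ⟨e, (Finset.mem_filter.1 he).1, h⟩
  choose e he hef using this
  refine ⟨e, he, fun i j hij => ?_, fun i j hij => ?_⟩
  · by_contra! hc
    have h1 : rank (row (e i)) < rank (row (e j)) := by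
      have := hf1 hij
      simpa only [← hef] using this
    rcases hc.eq_or_lt with hc | hc
    · rw [hc] at h1; exact lt_irrefl _ h1
    · exact lt_asymm h1 (hrank_lt _ (Finset.mem_image_of_mem _ (he j)) _ hc)
  · have := hf2 hij
    simpa only [← hef] using this

/-- A finite sequence of coloured points of the line can be cut greedily into pieces with at most
`n` colours, all of which except possibly the last have exactly `n` colours. The set `T` contains
the first points of the pieces other than the first one, so that the number of the piece of a
point is the number of elements of `T` that do not exceed it. -/
theorem exists_greedy_cuts {β γ : Type*} [DecidableEq γ] (x : β → ℝ) (col : β → γ) {n : ℕ}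
    (hn : 1 ≤ n) (E : Finset β) (hx : Set.InjOn x (E : Set β)) :
    ∃ T ⊆ E.image x,
      (∀ i, ((E.filter fun e => (T.filter (· ≤ x e)).card = i).image col).card ≤ n) ∧
      ∀ i < T.card, n ≤ ((E.filter fun e => (T.filter (· ≤ x e)).card = i).image col).card := by
  classical
  induction hN : E.card using Nat.strong_induction_on generalizing E with
  | _ N ih =>
  by_cases hE : (E.image col).card ≤ n
  · exact ⟨∅, by simp, fun i => (Finset.card_le_card
      (Finset.image_subset_image (Finset.filter_subset _ _))).trans hE, by simp⟩
  push Not at hE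
  -- `e₀` is the first point at which the number of colours exceeds `n`
  have hne : (E.filter fun e => n < ((E.filter fun e' => x e' ≤ x e).image col).card).Nonempty := by
    obtain ⟨e, he, hmax⟩ := Finset.exists_max_image E x (by
      rw [Finset.nonempty_iff_ne_empty]; rintro rfl; simp at hE)
    refine ⟨e, Finset.mem_filter.2 ⟨he, ?_⟩⟩
    rwa [Finset.filter_true_of_mem hmax]
  obtain ⟨e₀, he₀, hmin⟩ := Finset.exists_min_image _ x hne
  rw [Finset.mem_filter] at he₀
  set A := E.filter fun e => x e < x e₀ with hA
  set E' := E.filter fun e => x e₀ ≤ x e with hE'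
  have hsplit : (E.filter fun e' => x e' ≤ x e₀) = insert e₀ A := by
    ext e
    simp only [hA, Finset.mem_filter, Finset.mem_insert]
    constructor
    · rintro ⟨he, hle⟩
      rcases hle.eq_or_lt with h | h
      · exact Or.inl (hx he he₀.1 h)
      · exact Or.inr ⟨he, h⟩
    · rintro (rfl | h)
      · exact ⟨he₀.1, le_rfl⟩
      · exact ⟨h.1, h.2.le⟩
  have hAge : n ≤ (A.image col).card := by
    have := he₀.2
    rw [hsplit, Finset.image_insert] at this
    have := Finset.card_insert_le (col e₀) (A.image col)
    omega
  have hAle : (A.image col).card ≤ n := by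
    rcases A.eq_empty_or_nonempty with h | h
    · simp [h]
    · obtain ⟨e, he, hmax⟩ := Finset.exists_max_image A x h
      have he' := Finset.mem_filter.1 he
      have hnot : ¬ n < ((E.filter fun e' => x e' ≤ x e).image col).card := fun hc =>
        absurd (hmin e (Finset.mem_filter.2 ⟨he'.1, hc⟩)) (not_le.2 he'.2)
      refine le_trans (Finset.card_le_card (Finset.image_subset_image ?_)) (not_lt.1 hnot)
      intro e' h'
      exact Finset.mem_filter.2 ⟨(Finset.mem_filter.1 h').1, hmax e' h'⟩
  have hE'lt : E'.card < N := by
    rw [← hN]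
    refine Finset.card_lt_card
      (Finset.ssubset_iff_of_subset (Finset.filter_subset _ _) |>.2 ?_)
    have : A.Nonempty := by
      rw [Finset.nonempty_iff_ne_empty]; intro h; rw [h] at hAge; simp at hAge; omega
    obtain ⟨e, he⟩ := this
    refine ⟨e, (Finset.mem_filter.1 he).1, fun hc => ?_⟩
    exact absurd (Finset.mem_filter.1 hc).2 (not_le.2 (Finset.mem_filter.1 he).2)
  obtain ⟨T, hT, hTle, hTge⟩ := ih _ hE'lt E' (hx.mono (by
    exact_mod_cast Finset.filter_subset _ _)) rfl
  have hTx : ∀ t ∈ T, x e₀ ≤ t := fun t ht => by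
    obtain ⟨e, he, rfl⟩ := Finset.mem_image.1 (hT ht)
    exact (Finset.mem_filter.1 he).2
  have hnotMem : x e₀ ∉ T := by
    intro hmem
    -- the first piece of `E'` would be empty
    have := hTge 0 (Finset.card_pos.2 ⟨_, hmem⟩)
    rw [Finset.filter_false_of_mem] at this
    · simp at this; omega
    · intro e he
      refine (Finset.card_pos.2 ⟨x e₀, Finset.mem_filter.2 ⟨hmem, ?_⟩⟩).ne'
      exact (Finset.mem_filter.1 he).2
  have hlow : ∀ e, x e < x e₀ → ((insert (x e₀) T).filter (· ≤ x e)).card = 0 := fun e he => by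
    rw [Finset.card_eq_zero, Finset.filter_false_of_mem]
    intro t ht
    rcases Finset.mem_insert.1 ht with rfl | ht
    · exact not_le.2 he
    · exact not_le.2 (he.trans_le (hTx t ht))
  have hhigh : ∀ e, x e₀ ≤ x e →
      ((insert (x e₀) T).filter (· ≤ x e)).card = (T.filter (· ≤ x e)).card + 1 := fun e he => by
    rw [Finset.filter_insert, if_pos he, Finset.card_insert_of_notMem]
    exact fun h => hnotMem (Finset.mem_filter.1 h).1
  have hzero : (E.filter fun e => ((insert (x e₀) T).filter (· ≤ x e)).card = 0) = A := by
    refine Finset.filter_congr fun e _ => ⟨fun h => ?_, fun h => hlow e h⟩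
    by_contra! hc
    rw [hhigh e hc] at h
    omega
  have hsucc : ∀ i, (E.filter fun e => ((insert (x e₀) T).filter (· ≤ x e)).card = i + 1) =
      E'.filter fun e => (T.filter (· ≤ x e)).card = i := by
    intro i
    rw [hE', Finset.filter_filter]
    refine Finset.filter_congr fun e _ => ⟨fun h => ?_, fun h => ?_⟩
    · have hle : x e₀ ≤ x e := by
        by_contra! hc
        rw [hlow e hc] at h
        omega
      rw [hhigh e hle] at h
      exact ⟨hle, by omega⟩
    · rw [hhigh e h.1, h.2]
  refine ⟨insert (x e₀) T, ?_, fun i => ?_, fun i hi => ?_⟩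
  · refine Finset.insert_subset (Finset.mem_image_of_mem _ he₀.1) (hT.trans ?_)
    exact Finset.image_subset_image (Finset.filter_subset _ _)
  · cases i with
    | zero => rw [hzero]; exact hAle
    | succ i => rw [hsucc]; exact hTle i
  · cases i with
    | zero => rw [hzero]; exact hAge
    | succ i =>
      rw [hsucc]
      rw [Finset.card_insert_of_notMem hnotMem] at hi
      exact hTge i (by omega)

/-! ### Intervals that cross the boundary of an arch -/

namespace IntervalSystem

variable {S : IntervalSystem} {l : List ℝ} {a b p : ℝ} {I J : ℝ × ℝ}

/-- A coloured interval with an endpoint in the arch `(a, b)`. It contains a pillar, so its other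
endpoint is not in the arch. -/
def IsCrosser (S : IntervalSystem) (l : List ℝ) (a b : ℝ) (I : ℝ × ℝ) : Prop :=
  S.colouringRev l I ≠ none ∧ (I.1 ∈ Ioo a b ∨ I.2 ∈ Ioo a b)

open scoped Classical in
/-- The endpoint of a crossing interval inside the arch `(a, b)`. -/
noncomputable def inner (a b : ℝ) (I : ℝ × ℝ) : ℝ := if I.2 ∈ Ioo a b then I.2 else I.1

open scoped Classical in
/-- The endpoint of a crossing interval outside the arch `(a, b)`, in the coordinate along the
rest of the circle that starts at `b`: points to the right of the arch are shifted by `-2`, so that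
they come before the points to the left of the arch. -/
noncomputable def outer (a b : ℝ) (I : ℝ × ℝ) : ℝ := if I.2 ∈ Ioo a b then I.1 else I.2 - 2

/-- The label of a crossing interval, with the pillars in the same circular order as in `outer`,
and the labels ordered lexicographically. -/
noncomputable def row (S : IntervalSystem) (l : List ℝ) (a : ℝ) (I : ℝ × ℝ) : ℝ ×ₗ ℕ :=
  toLex (if (S.label l I).1 ≤ a then (S.label l I).1 else (S.label l I).1 - 1, (S.label l I).2)

theorem row_lt_iff : S.row l a I < S.row l a J ↔
    ((if (S.label l I).1 ≤ a then (S.label l I).1 else (S.label l I).1 - 1) <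
      if (S.label l J).1 ≤ a then (S.label l J).1 else (S.label l J).1 - 1) ∨
    ((if (S.label l I).1 ≤ a then (S.label l I).1 else (S.label l I).1 - 1) =
      if (S.label l J).1 ≤ a then (S.label l J).1 else (S.label l J).1 - 1) ∧
      (S.label l I).2 < (S.label l J).2 := by
  simp [row, Prod.Lex.toLex_lt_toLex]

theorem label_eq_of_row_eq (hp : ∀ p ∈ l, p ∈ Ioo (0 : ℝ) 1) (hI : S.colouringRev l I ≠ none)
    (hJ : S.colouringRev l J ≠ none) (h : S.row l a I = S.row l a J) :
    S.label l I = S.label l J := by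
  have h1 := hp _ (label_spec hI).1
  have h2 := hp _ (label_spec hJ).1
  simp only [row, EmbeddingLike.apply_eq_iff_eq, Prod.mk.injEq] at h
  refine Prod.ext ?_ h.2
  have h3 := h.1
  split_ifs at h3 <;> linarith [h1.1, h1.2, h2.1, h2.2]

theorem row_eq_of_label_eq (h : S.label l I = S.label l J) : S.row l a I = S.row l a J := by
  simp [row, h]

/-- A crossing interval leaves the arch either to the left or to the right. -/
theorem IsCrosser.cases (hab : ∀ q ∈ l, q ∉ Ioo a b) (h : S.IsCrosser l a b I) :
    (I.2 ∈ Ioo a b ∧ I.1 < (S.label l I).1 ∧ (S.label l I).1 ≤ a ∧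
      inner a b I = I.2 ∧ outer a b I = I.1) ∨
    (I.1 ∈ Ioo a b ∧ b ≤ (S.label l I).1 ∧ (S.label l I).1 < I.2 ∧
      inner a b I = I.1 ∧ outer a b I = I.2 - 2) := by
  obtain ⟨h1, h2, -⟩ := label_spec h.1
  have h3 := hab _ h1
  by_cases hI : I.2 ∈ Ioo a b
  · refine Or.inl ⟨hI, h2.1, ?_, by simp [inner, hI], by simp [outer, hI]⟩
    by_contra! hc
    exact h3 ⟨hc, h2.2.trans hI.2⟩
  · have hI1 := h.2.resolve_right hI
    refine Or.inr ⟨hI1, ?_, h2.2, by simp only [inner, if_neg hI], by simp only [outer, if_neg hI]⟩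
    by_contra! hc
    exact h3 ⟨hI1.1.trans h2.1, hc⟩

theorem IsCrosser.mem_intervals (h : S.IsCrosser l a b I) : I ∈ S.intervals :=
  (colouringRev_ne_none_iff.1 h.1).1

theorem IsCrosser.inner_mem (hab : ∀ q ∈ l, q ∉ Ioo a b) (h : S.IsCrosser l a b I) :
    inner a b I ∈ Ioo a b := by
  rcases h.cases hab with ⟨h1, -, -, h2, -⟩ | ⟨h1, -, -, h2, -⟩ <;> rwa [h2]

theorem inner_eq (a b : ℝ) (I : ℝ × ℝ) : inner a b I = I.1 ∨ inner a b I = I.2 := by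
  unfold inner; split_ifs <;> simp

/-- Crossing intervals correspond to chords of a circle; they overlap when the chords cross. -/
theorem IsCrosser.overlap (hab : ∀ q ∈ l, q ∉ Ioo a b) (hI : S.IsCrosser l a b I)
    (hJ : S.IsCrosser l a b J) (hi : inner a b I < inner a b J)
    (ho : outer a b I < outer a b J) : Overlap I J := by
  rcases hI.cases hab with ⟨h1, h2, h3, h4, h5⟩ | ⟨h1, h2, h3, h4, h5⟩ <;>
    rcases hJ.cases hab with ⟨k1, k2, k3, k4, k5⟩ | ⟨k1, k2, k3, k4, k5⟩ <;>
    rw [h4, k4] at hi <;> rw [h5, k5] at ho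
  · exact Precedes.overlap ⟨ho, hi⟩ (by linarith [h1.1])
  · linarith [S.nonneg I hI.mem_intervals, S.le_one J hJ.mem_intervals]
  · exact (Precedes.overlap (I := J) (J := I) ⟨by linarith [h1.1], by linarith [k1.2]⟩ hi).symm
  · exact Precedes.overlap ⟨hi, by linarith⟩ (by linarith [k1.2])

/-- Of two crossing intervals whose labels increase strictly together with their inner endpoints,
the first one can be replaced by one with the same label and no smaller inner endpoint, so that
the two become crossing chords. -/
theorem IsCrosser.exists_outer_lt (hl : l.Nodup) (hp : ∀ p ∈ l, p ∈ Ioo (0 : ℝ) 1)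
    (hab : ∀ q ∈ l, q ∉ Ioo a b) (hI : S.IsCrosser l a b I) (hJ : S.IsCrosser l a b J)
    (hi : inner a b I < inner a b J) (hr : S.row l a I < S.row l a J) :
    ∃ I', S.IsCrosser l a b I' ∧ S.row l a I' = S.row l a I ∧ inner a b I ≤ inner a b I' ∧
      inner a b I' < inner a b J ∧ outer a b I' < outer a b J := by
  obtain ⟨sI1, sI2, sI3⟩ := label_spec hI.1
  obtain ⟨sJ1, sJ2, sJ3⟩ := label_spec hJ.1
  have bI := hp _ sI1
  have bJ := hp _ sJ1
  have hlt := hi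
  rw [row_lt_iff] at hr
  by_cases hne : (S.label l I).1 = (S.label l J).1
  · -- the same pillar: pass to an interval below `J` with the height of `I`
    have hh : (S.label l I).2 < (S.label l J).2 := by
      rw [hne] at hr
      exact hr.resolve_left (lt_irrefl _) |>.2
    obtain ⟨I', hI', hI'J, hlab⟩ := exists_precedes_label_eq sI3 hJ.1 hh
    have hlab' : S.label l I' = S.label l I := hlab.trans (Prod.ext hne.symm rfl)
    have hn1 : ¬ Precedes I I' := fun h =>
      (label_snd_lt_of_precedes hl hI.1 hI' (by rw [hlab']) h).ne (by rw [hlab'])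
    have hn2 : ¬ Precedes I' I := fun h =>
      (label_snd_lt_of_precedes hl hI' hI.1 (by rw [hlab']) h).ne (by rw [hlab'])
    simp only [Precedes, not_and, not_lt] at hn1 hn2
    rcases hI.cases hab with ⟨h1, h2, h3, h4, h5⟩ | ⟨h1, h2, h3, h4, h5⟩ <;>
      rcases hJ.cases hab with ⟨k1, k2, k3, k4, k5⟩ | ⟨k1, k2, k3, k4, k5⟩
    · rw [h4, k4] at hi
      rcases le_or_gt I.2 I'.2 with hle | hlt'
      · have hmem : I'.2 ∈ Ioo a b := ⟨h1.1.trans_le hle, hI'J.2.trans k1.2⟩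
        have e1 : inner a b I' = I'.2 := by simp [inner, hmem]
        have e2 : outer a b I' = I'.1 := by simp [outer, hmem]
        refine ⟨I', ⟨hI', Or.inr hmem⟩, row_eq_of_label_eq hlab', ?_, ?_, ?_⟩
        · rw [h4, e1]; exact hle
        · rw [k4, e1]; exact hI'J.2
        · rw [k5, e2]; exact hI'J.1
      · have : I.1 < J.1 := by
          by_contra! hc
          exact absurd (hn2 (hI'J.1.trans_le hc)) (not_le.2 hlt')
        exact ⟨I, hI, rfl, le_rfl, hlt, by rw [h5, k5]; exact this⟩
    · linarith [h1.1, h1.2]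
    · linarith [h1.1, h1.2]
    · rw [h4, k4] at hi
      rcases le_or_gt I.1 I'.1 with hle | hlt'
      · have hmem : I'.1 ∈ Ioo a b := ⟨h1.1.trans_le hle, hI'J.1.trans k1.2⟩
        have hc : S.IsCrosser l a b I' := ⟨hI', Or.inl hmem⟩
        have hlab1 : (S.label l I').1 = (S.label l I).1 := by rw [hlab']
        obtain ⟨e1, e2⟩ : inner a b I' = I'.1 ∧ outer a b I' = I'.2 - 2 := by
          rcases hc.cases hab with ⟨-, -, m, -⟩ | ⟨-, -, -, m⟩
          · linarith [h1.1, h1.2]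
          · exact m
        refine ⟨I', hc, row_eq_of_label_eq hlab', ?_, ?_, ?_⟩
        · rw [h4, e1]; exact hle
        · rw [k4, e1]; exact hI'J.1
        · rw [k5, e2]; linarith [hI'J.2]
      · have : I.2 < J.2 := (hn2 hlt').trans_lt hI'J.2
        exact ⟨I, hI, rfl, le_rfl, hlt, by rw [h5, k5]; linarith⟩
  · -- different pillars: the outer endpoints are separated by the pillar that comes first
    refine ⟨I, hI, rfl, le_rfl, hlt, ?_⟩
    have hsep := label_notMem_or hl hI.1 hJ.1 hne
    rcases hI.cases hab with ⟨h1, h2, h3, h4, h5⟩ | ⟨h1, h2, h3, h4, h5⟩ <;>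
      rcases hJ.cases hab with ⟨k1, k2, k3, k4, k5⟩ | ⟨k1, k2, k3, k4, k5⟩ <;>
      rw [h5, k5] <;> clear h4 k4 h5 k5
    · rw [if_pos h3, if_pos k3] at hr
      have hr : (S.label l I).1 < (S.label l J).1 := hr.resolve_right fun h => hne h.1
      rcases hsep with h | h
      · by_contra! hc
        exact h ⟨by linarith, by linarith [k1.1]⟩
      · exact absurd ⟨by linarith, by linarith [h1.1]⟩ h
    · rw [if_pos h3, if_neg (by linarith [k1.1, k1.2])] at hr
      rcases hr with hr | ⟨hr, -⟩ <;> linarith [bI.1, bJ.2]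
    · linarith [S.nonneg J hJ.mem_intervals, S.le_one I hI.mem_intervals]
    · rw [if_neg (by linarith [h1.1, h1.2]), if_neg (by linarith [k1.1, k1.2])] at hr
      have hr : (S.label l I).1 < (S.label l J).1 := by
        rcases hr with hr | hr
        · linarith
        · exact absurd (by linarith [hr.1]) hne
      rcases hsep with h | h
      · exact absurd ⟨by linarith [k1.2], by linarith⟩ h
      · by_contra! hc
        exact h ⟨by linarith [h1.2], by linarith⟩

/-- If the clique number is at most three, then there are no four crossing intervals whose labels
increase strictly together with their inner endpoints. -/
theorem false_of_increasing_crossers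
    (hS : ∀ U ⊆ S.intervals, (U : Set (ℝ × ℝ)).Pairwise Overlap → U.card ≤ 3)
    (hl : l.Nodup) (hp : ∀ p ∈ l, p ∈ Ioo (0 : ℝ) 1)
    (hab : ∀ q ∈ l, q ∉ Ioo a b) {e : Fin 4 → ℝ × ℝ} (he : ∀ i, S.IsCrosser l a b (e i))
    (hi : StrictMono fun i => inner a b (e i)) (hr : StrictMono fun i => S.row l a (e i)) :
    False := by
  classical
  obtain ⟨c₂, hc₂, hr₂, hle₂, hi₂, ho₂⟩ := (he 2).exists_outer_lt hl hp hab (he 3)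
    (hi (by decide : (2 : Fin 4) < 3)) (hr (by decide : (2 : Fin 4) < 3))
  obtain ⟨c₁, hc₁, hr₁, hle₁, hi₁, ho₁⟩ := (he 1).exists_outer_lt hl hp hab hc₂
    ((hi (by decide : (1 : Fin 4) < 2)).trans_le hle₂)
    (hr₂ ▸ hr (by decide : (1 : Fin 4) < 2))
  obtain ⟨c₀, hc₀, hr₀, hle₀, hi₀, ho₀⟩ := (he 0).exists_outer_lt hl hp hab hc₁
    ((hi (by decide : (0 : Fin 4) < 1)).trans_le hle₁)
    (hr₁ ▸ hr (by decide : (0 : Fin 4) < 1))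
  set c : Fin 4 → ℝ × ℝ := ![c₀, c₁, c₂, e 3] with hc
  have hcr : ∀ i, S.IsCrosser l a b (c i) := by
    intro i
    fin_cases i
    exacts [hc₀, hc₁, hc₂, he 3]
  have hin : StrictMono fun i => inner a b (c i) := by
    rw [Fin.strictMono_iff_lt_succ]
    intro i
    fin_cases i
    exacts [hi₀, hi₁, hi₂]
  have hout : StrictMono fun i => outer a b (c i) := by
    rw [Fin.strictMono_iff_lt_succ]
    intro i
    fin_cases i
    exacts [ho₀, ho₁, ho₂]
  have hinj : Function.Injective c := fun i j hij => hin.injective (congrArg (inner a b) hij)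
  have := hS (Finset.univ.image c)
    (fun I h => by
      obtain ⟨i, -, rfl⟩ := Finset.mem_image.1 h
      exact (hcr i).mem_intervals)
    (by
      intro I h J h' hne
      obtain ⟨i, -, rfl⟩ := Finset.mem_image.1 (Finset.mem_coe.1 h)
      obtain ⟨j, -, rfl⟩ := Finset.mem_image.1 (Finset.mem_coe.1 h')
      rcases lt_trichotomy i j with hij | rfl | hij
      · exact (hcr i).overlap hab (hcr j) (hin hij) (hout hij)
      · exact absurd rfl hne
      · exact ((hcr j).overlap hab (hcr i) (hin hij) (hout hij)).symm)
  rw [Finset.card_image_of_injective _ hinj] at this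
  simp at this

/-! ### Cutting an arch -/

open scoped Classical in
/-- The intervals with an endpoint in `K`. -/
noncomputable def withEndpointIn (S : IntervalSystem) (K : Set ℝ) : Finset (ℝ × ℝ) :=
  S.intervals.filter fun I => I.1 ∈ K ∨ I.2 ∈ K

theorem mem_withEndpointIn {K : Set ℝ} :
    I ∈ S.withEndpointIn K ↔ I ∈ S.intervals ∧ (I.1 ∈ K ∨ I.2 ∈ K) := by
  simp [withEndpointIn]

/-- The number of colours given to intervals with an endpoint in `K`, for pillars listed from the
last one to the first one. -/
noncomputable def colDegree (S : IntervalSystem) (l : List ℝ) (K : Set ℝ) : ℕ :=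
  (coloursUsed (S.colouringRev l) (S.withEndpointIn K)).card

/-- Between a point and the endpoints to its left there is room for a pillar. -/
theorem exists_pillar_before (S : IntervalSystem) {z t : ℝ} (h0 : 0 ≤ z) (hzt : z < t)
    (h1 : t ≤ 1) : ∃ p ∈ Ioo z t, S.IsPillar p ∧
      ∀ I ∈ S.intervals, (I.1 < t → I.1 < p) ∧ (I.2 < t → I.2 < p) := by
  classical
  set Q : Finset ℝ := insert z
    ((S.intervals.image Prod.fst ∪ S.intervals.image Prod.snd).filter (· < t)) with hQ
  obtain ⟨m, hm, hmax⟩ := Finset.exists_max_image Q id ⟨z, by simp [hQ]⟩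
  have hmt : m < t := by
    rcases Finset.mem_insert.1 hm with rfl | h
    · exact hzt
    · exact (Finset.mem_filter.1 h).2
  obtain ⟨p, hmp, hpt⟩ := exists_between hmt
  have hz : z ≤ m := hmax z (by simp [hQ])
  have key : ∀ I ∈ S.intervals, (I.1 < t → I.1 < p) ∧ (I.2 < t → I.2 < p) := by
    intro I hI
    constructor <;> intro h
    · refine (hmax I.1 (Finset.mem_insert_of_mem (Finset.mem_filter.2 ⟨?_, h⟩))).trans_lt hmp
      exact Finset.mem_union_left _ (Finset.mem_image_of_mem _ hI)
    · refine (hmax I.2 (Finset.mem_insert_of_mem (Finset.mem_filter.2 ⟨?_, h⟩))).trans_lt hmp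
      exact Finset.mem_union_right _ (Finset.mem_image_of_mem _ hI)
  refine ⟨p, ⟨hz.trans_lt hmp, hpt⟩, ⟨⟨h0.trans_lt (hz.trans_lt hmp), hpt.trans_le h1⟩,
    fun I hI => ⟨?_, ?_⟩⟩, key⟩
  · rintro rfl; exact lt_irrefl _ ((key I hI).1 hpt)
  · rintro rfl; exact lt_irrefl _ ((key I hI).2 hpt)

/-- An arch of degree at most `13` has at most seven cuts that split it into pieces of degree at
most seven. Each cut is placed immediately before an endpoint of a coloured interval, which
therefore overlaps all uncoloured intervals that contain the cut. -/
theorem exists_cuts (hS : ∀ U ⊆ S.intervals, (U : Set (ℝ × ℝ)).Pairwise Overlap → U.card ≤ 3)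
    (hl : l.Nodup) (hp : ∀ p ∈ l, S.IsPillar p) (h0 : 0 ≤ a) (h1 : b ≤ 1)
    (hab : ∀ q ∈ l, q ∉ Ioo a b) (hdeg : S.colDegree l (Ioo a b) ≤ 13) :
    ∃ T : Finset ℝ, T.card < 8 ∧
      (∀ t ∈ T, t ∈ Ioo a b ∧ S.IsPillar t ∧ ∃ I ∈ S.intervals, ∀ X ∈ S.intervals,
        S.colouringRev l X = none → t ∈ Ioo X.1 X.2 → Overlap X I) ∧
      ∀ c d, a ≤ c → d ≤ b → (∀ t ∈ T, t ∉ Ioo c d) → S.colDegree l (Ioo c d) ≤ 7 := by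
  classical
  have hp' : ∀ p ∈ l, p ∈ Ioo (0 : ℝ) 1 := fun p hpl => (hp p hpl).1
  set E := S.intervals.filter (S.IsCrosser l a b) with hE
  have hEmem : ∀ I, I ∈ E ↔ S.IsCrosser l a b I := fun I => by
    rw [hE, Finset.mem_filter]
    exact ⟨fun h => h.2, fun h => ⟨h.mem_intervals, h⟩⟩
  have hinj : Set.InjOn (inner a b) (E : Set (ℝ × ℝ)) := by
    intro I hI J hJ hIJ
    by_contra hne
    have hI := (hEmem I).1 hI
    have hJ := (hEmem J).1 hJ
    have := S.endpoints_ne I hI.mem_intervals J hJ.mem_intervals hne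
    rcases inner_eq a b I with h | h <;> rcases inner_eq a b J with h' | h' <;>
      rw [h, h'] at hIJ <;> tauto
  -- within the arch, counting colours is the same as counting labels
  have hrow : (E.image (S.row l a)).card ≤ 13 := by
    refine le_trans ?_ hdeg
    unfold colDegree
    have : ∀ I ∈ E, ∃ c, S.colouringRev l I = some c := fun I hI =>
      Option.ne_none_iff_exists'.1 ((hEmem I).1 hI).1
    choose! ψ hψ using this
    have hle : (E.image (S.row l a)).card ≤ (E.image ψ).card := by
      set g : ℕ → ℝ ×ₗ ℕ := fun c => if h : ∃ I ∈ E, ψ I = c then S.row l a h.choose else toLex 0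
      refine Finset.card_le_card_of_surjOn g ?_
      intro y hy
      obtain ⟨I, hI, rfl⟩ := Finset.mem_image.1 (Finset.mem_coe.1 hy)
      refine ⟨ψ I, Finset.mem_coe.2 (Finset.mem_image_of_mem _ hI), ?_⟩
      have hex : ∃ J ∈ E, ψ J = ψ I := ⟨I, hI, rfl⟩
      obtain ⟨hJ, hJI⟩ := hex.choose_spec
      have hgI : g (ψ I) = S.row l a hex.choose := dif_pos hex
      rw [hgI]
      have hJc := (hEmem _).1 hJ
      refine row_eq_of_label_eq (label_eq_of_colouringRev_eq hl hp h0 h1 hab hJc.1 hJc.2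
        ((hEmem I).1 hI).2 ?_)
      rw [hψ _ hJ, hψ _ hI, hJI]
    refine hle.trans (Finset.card_le_card ?_)
    intro c hc
    obtain ⟨I, hI, rfl⟩ := Finset.mem_image.1 hc
    have hIc := (hEmem I).1 hI
    exact mem_coloursUsed.2 ⟨I, mem_withEndpointIn.2 ⟨hIc.mem_intervals, hIc.2⟩, hψ I hI⟩
  obtain ⟨T, hT, hTle, hTge⟩ :=
    exists_greedy_cuts (inner a b) (S.row l a) (n := 7) (by norm_num) E hinj
  have hT8 : T.card < 8 := by
    by_contra! hc
    obtain ⟨e, he, hr, hpc⟩ := exists_increasing_of_pieces hrow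
      fun i hi => hTge i (hi.trans_le hc)
    refine false_of_increasing_crossers hS hl hp' hab (fun i => (hEmem _).1 (he i)) ?_ hr
    intro i j hij
    by_contra! hc
    refine absurd (hpc hij) (not_lt.2 (Finset.card_le_card ?_))
    intro t ht
    rw [Finset.mem_filter] at ht ⊢
    exact ⟨ht.1, ht.2.trans hc⟩
  have hTx : ∀ t ∈ T, ∃ I, S.IsCrosser l a b I ∧ inner a b I = t := fun t ht => by
    obtain ⟨I, hI, rfl⟩ := Finset.mem_image.1 (hT ht)
    exact ⟨I, (hEmem I).1 hI, rfl⟩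
  have hcut : ∀ t ∈ T, ∃ p ∈ Ioo a t, S.IsPillar p ∧
      ∀ I ∈ S.intervals, (I.1 < t → I.1 < p) ∧ (I.2 < t → I.2 < p) := fun t ht => by
    obtain ⟨I, hI, rfl⟩ := hTx t ht
    have := hI.inner_mem hab
    exact S.exists_pillar_before h0 this.1 (this.2.le.trans h1)
  choose! f hfm hfp hf using hcut
  refine ⟨T.image f, Finset.card_image_le.trans_lt hT8, ?_, ?_⟩
  · intro q hq
    obtain ⟨t, ht, rfl⟩ := Finset.mem_image.1 hq
    obtain ⟨I, hI, hIt⟩ := hTx t ht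
    have hmem := hI.inner_mem hab
    rw [hIt] at hmem
    refine ⟨⟨(hfm t ht).1, (hfm t ht).2.trans hmem.2⟩, hfp t ht, I, hI.mem_intervals, ?_⟩
    intro X hX hXnone hqX
    obtain ⟨hr1, hr2, -⟩ := label_spec hI.1
    have hrX : (S.label l I).1 ∉ Ioo X.1 X.2 := fun h =>
      absurd hXnone (colouringRev_ne_none_iff.2 ⟨hX, _, hr1, h⟩)
    have hXI : X ≠ I := by rintro rfl; exact hI.1 hXnone
    have hends : t ≠ X.2 := by
      have := S.endpoints_ne X hX I hI.mem_intervals hXI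
      rw [← hIt]
      rcases inner_eq a b I with h | h <;> rw [h]
      · exact this.2.2.1.symm
      · exact this.2.2.2.symm
    -- no endpoint lies between the cut and `t`, so `X` contains `t`
    have htX : t ∈ Ioo X.1 X.2 := by
      refine ⟨hqX.1.trans (hfm t ht).2, lt_of_le_of_ne ?_ hends⟩
      by_contra! hc
      exact lt_asymm hqX.2 ((hf t ht X hX).2 hc)
    refine overlap_of_endpoint_mem (S.lt I hI.mem_intervals) htX ?_ hr2 hrX
    rw [← hIt]
    exact inner_eq a b I
  · intro c d hac hdb hcd
    -- all crossing intervals with an endpoint in `(c, d)` belong to the same piece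
    have hpiece : ∀ I J, S.IsCrosser l a b I → S.IsCrosser l a b J → inner a b I ∈ Ioo c d →
        inner a b J ∈ Ioo c d →
        (T.filter (· ≤ inner a b I)) ⊆ (T.filter (· ≤ inner a b J)) := by
      intro I J hI hJ hIc hJc t ht
      rw [Finset.mem_filter] at ht ⊢
      refine ⟨ht.1, ?_⟩
      by_contra! hlt
      refine hcd (f t) (Finset.mem_image_of_mem _ ht.1)
        ⟨hJc.1.trans ?_, (hfm t ht.1).2.trans_le (ht.2.trans hIc.2.le)⟩
      rcases inner_eq a b J with h | h <;> rw [h] at hlt ⊢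
      · exact (hf t ht.1 J hJ.mem_intervals).1 hlt
      · exact (hf t ht.1 J hJ.mem_intervals).2 hlt
    have hcross : ∀ I, S.colouringRev l I ≠ none → (I.1 ∈ Ioo c d ∨ I.2 ∈ Ioo c d) →
        S.IsCrosser l a b I ∧ inner a b I ∈ Ioo c d := by
      intro I hI hIcd
      have hsub : Ioo c d ⊆ Ioo a b := Ioo_subset_Ioo hac hdb
      have hcr : S.IsCrosser l a b I := ⟨hI, hIcd.imp (fun h => hsub h) fun h => hsub h⟩
      refine ⟨hcr, ?_⟩
      rcases hcr.cases hab with ⟨-, k1, k2, k, -⟩ | ⟨-, k1, k2, k, -⟩ <;> rw [k]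
      · refine hIcd.resolve_left fun h => ?_
        linarith [h.1]
      · refine hIcd.resolve_right fun h => ?_
        linarith [h.2]
    unfold colDegree
    rcases (coloursUsed (S.colouringRev l) (S.withEndpointIn (Ioo c d))).eq_empty_or_nonempty with
      h | h
    · rw [h]; simp
    obtain ⟨c₀, hc₀⟩ := h
    obtain ⟨J, hJ, hJc₀⟩ := mem_coloursUsed.1 hc₀
    obtain ⟨hJ1, hJ2⟩ := hcross J (by simp [hJc₀]) (mem_withEndpointIn.1 hJ).2
    refine le_trans ?_ (hTle (T.filter (· ≤ inner a b J)).card)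
    set P := E.filter fun e => (T.filter (· ≤ inner a b e)).card =
      (T.filter (· ≤ inner a b J)).card with hP
    have hPmem : ∀ I ∈ S.withEndpointIn (Ioo c d),
        S.colouringRev l I ≠ none → I ∈ P := by
      intro I hI hIn
      obtain ⟨hI1, hI2⟩ := hcross I hIn (mem_withEndpointIn.1 hI).2
      refine Finset.mem_filter.2 ⟨(hEmem I).2 hI1, ?_⟩
      rw [(hpiece I J hI1 hJ1 hI2 hJ2).antisymm (hpiece J I hJ1 hI1 hJ2 hI2)]
    set g : ℝ ×ₗ ℕ → ℕ := fun y =>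
      if h : ∃ I ∈ P, S.row l a I = y then (S.colouringRev l h.choose).getD 0 else 0
    refine Finset.card_le_card_of_surjOn g ?_
    intro k hk
    obtain ⟨I, hI, hIk⟩ := mem_coloursUsed.1 (Finset.mem_coe.1 hk)
    have hIP := hPmem I hI (by simp [hIk])
    refine ⟨S.row l a I, Finset.mem_coe.2 (Finset.mem_image_of_mem _ hIP), ?_⟩
    have hex : ∃ J ∈ P, S.row l a J = S.row l a I := ⟨I, hIP, rfl⟩
    obtain ⟨hJ', hJI⟩ := hex.choose_spec
    have hgI : g (S.row l a I) = (S.colouringRev l hex.choose).getD 0 := dif_pos hex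
    have hJcr := (hEmem _).1 (Finset.mem_filter.1 hJ').1
    rw [hgI, colouringRev_eq_of_label_eq hl hJcr.1 (by simp [hIk])
      (label_eq_of_row_eq hp' hJcr.1 (by simp [hIk]) hJI), hIk]
    rfl

end IntervalSystem

/-! ### Adding one pillar -/

namespace IntervalSystem

variable {S : IntervalSystem} {l : List ℝ} {a b p q : ℝ} {I J : ℝ × ℝ}

theorem colDegree_mono {K L : Set ℝ} (h : K ⊆ L) : S.colDegree l K ≤ S.colDegree l L := by
  refine Finset.card_le_card (coloursUsed_mono fun I hI => ?_)
  rw [mem_withEndpointIn] at hI ⊢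
  exact ⟨hI.1, hI.2.imp (fun h' => h h') fun h' => h h'⟩

theorem colDegree_le_of_eq {l' : List ℝ} {K : Set ℝ}
    (h : ∀ I ∈ S.withEndpointIn K, S.colouringRev l' I = S.colouringRev l I) :
    S.colDegree l' K ≤ S.colDegree l K := by
  refine Finset.card_le_card fun c hc => ?_
  obtain ⟨I, hI, hc⟩ := mem_coloursUsed.1 hc
  exact mem_coloursUsed.2 ⟨I, hI, (h I hI).symm.trans hc⟩

theorem colDegree_cons_le (K : Set ℝ) :
    S.colDegree (q :: l) K ≤ S.colDegree l K + cliqueNumber (S.assigned l q) := by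
  classical
  have hsub : coloursUsed (S.colouringRev (q :: l)) (S.withEndpointIn K) ⊆
      coloursUsed (S.colouringRev l) (S.withEndpointIn K) ∪ S.palette l q := by
    intro c hc
    obtain ⟨I, hI, hc⟩ := mem_coloursUsed.1 hc
    by_cases h : I ∈ S.assigned l q
    · rw [colouringRev_cons_of_mem h, Option.some_inj] at hc
      exact Finset.mem_union_right _ (hc ▸ permutationColouring_mem_palette h)
    · rw [colouringRev_cons_of_notMem h] at hc
      exact Finset.mem_union_left _ (mem_coloursUsed.2 ⟨I, hI, hc⟩)
  have := (Finset.card_le_card hsub).trans (Finset.card_union_le _ _)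
  rwa [show (S.palette l q).card = _ from card_smallestColours _ _] at this

/-- All colours available at a new pillar are at most the degree of its foundation plus the
number of new colours. -/
theorem le_of_colouringRev_cons_eq {n c : ℕ} (hF : foundation l q = Ioo a b)
    (hdeg : S.colDegree l (Ioo a b) + cliqueNumber (S.assigned l q) ≤ n)
    (hl : ∀ I c, S.colouringRev l I = some c → c ≤ n)
    (hc : S.colouringRev (q :: l) I = some c) : c ≤ n := by
  by_cases h : I ∈ S.assigned l q
  · rw [colouringRev_cons_of_mem h, Option.some_inj] at hc
    have h1 := le_of_mem_smallestColours (permutationColouring_mem_palette h)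
    rw [hc, hF] at h1
    refine (h1.trans ?_).trans hdeg
    refine Nat.add_le_add_right (Finset.card_le_card (coloursUsed_mono fun J hJ => ?_)) _
    rw [mem_oneEndpointIn] at hJ
    rw [mem_withEndpointIn]
    exact ⟨hJ.1, by tauto⟩
  · rw [colouringRev_cons_of_notMem h] at hc
    exact hl I c hc

/-- A pillar is cheap if all uncoloured intervals through it overlap one further interval. The
intervals assigned to it then need one colour less. -/
def IsCheap (S : IntervalSystem) (l : List ℝ) (t : ℝ) : Prop :=
  S.IsPillar t ∧ ∃ I ∈ S.intervals, ∀ X ∈ S.intervals,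
    S.colouringRev l X = none → t ∈ Ioo X.1 X.2 → Overlap X I

theorem colouringRev_eq_none_of_mem_assigned (h : I ∈ S.assigned l p) :
    S.colouringRev l I = none := by
  by_contra hc
  obtain ⟨-, q, hq, hqI⟩ := colouringRev_ne_none_iff.1 hc
  exact (mem_assigned.1 h).2.2 q hq hqI

theorem IsCheap.cliqueNumber_le {t : ℝ} {n : ℕ} (h : S.IsCheap l t)
    (hS : ∀ U ⊆ S.intervals, (U : Set (ℝ × ℝ)).Pairwise Overlap → U.card ≤ n + 1) :
    cliqueNumber (S.assigned l t) ≤ n := by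
  classical
  obtain ⟨-, I, hI, hover⟩ := h
  refine _root_.cliqueNumber_le fun U hU hUp => ?_
  have hUI : ∀ X ∈ U, Overlap X I := fun X hX => by
    have h1 := mem_assigned.1 (hU hX)
    exact hover X h1.1 (colouringRev_eq_none_of_mem_assigned (hU hX)) h1.2.1
  have hnot : I ∉ U := fun h => Overlap.irrefl I (hUI I h)
  have := hS (insert I U)
    (Finset.insert_subset hI fun X hX => (mem_assigned.1 (hU hX)).1)
    (by
      rw [Finset.coe_insert]
      exact hUp.insert fun X hX _ => ⟨(hUI X hX).symm, hUI X hX⟩)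
  rw [Finset.card_insert_of_notMem hnot] at this
  omega

theorem IsCheap.cons {t : ℝ} (h : S.IsCheap l t) : S.IsCheap (q :: l) t := by
  obtain ⟨ht, I, hI, hover⟩ := h
  refine ⟨ht, I, hI, fun X hX hnone => hover X hX ?_⟩
  by_contra hc
  exact hc (by rwa [colouringRev_cons_of_ne_none hc] at hnone)

namespace PillarAssignment

variable {A B : S.PillarAssignment} {c d : ℝ}

/-- The pillar assignment with one more pillar, which comes last. -/
def snoc (A : S.PillarAssignment) (q : ℝ) (hq : S.IsPillar q) (hqA : q ∉ A.pillars) :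
    S.PillarAssignment where
  pillars := A.pillars ++ [q]
  nodup := by
    rw [List.nodup_append]
    refine ⟨A.nodup, by simp, fun x hx y hy => ?_⟩
    rw [List.mem_singleton.1 hy]
    rintro rfl
    exact hqA hx
  isPillar p hp := by
    rcases List.mem_append.1 hp with h | h
    · exact A.isPillar p h
    · rwa [List.mem_singleton.1 h]

theorem reverse_snoc {hq : S.IsPillar q} {hqA : q ∉ A.pillars} :
    (A.snoc q hq hqA).pillars.reverse = q :: A.pillars.reverse := by
  simp [snoc]

theorem mem_snoc {hq : S.IsPillar q} {hqA : q ∉ A.pillars} :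
    p ∈ (A.snoc q hq hqA).pillars ↔ p ∈ A.pillars ∨ p = q := by
  simp [snoc]

theorem prefix_snoc {hq : S.IsPillar q} {hqA : q ∉ A.pillars} :
    A.pillars <+: (A.snoc q hq hqA).pillars := ⟨[q], rfl⟩

theorem ψ_eq (A : S.PillarAssignment) : A.ψ = S.colouringRev A.pillars.reverse := rfl

theorem degree_eq (A : S.PillarAssignment) (K : Set ℝ) :
    A.degree K = S.colDegree A.pillars.reverse K := rfl

theorem ψ_ne_none_iff : A.ψ I ≠ none ↔ I ∈ S.intervals ∧ ∃ p ∈ A.pillars, p ∈ Ioo I.1 I.2 := by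
  simp [ψ_eq, colouringRev_ne_none_iff]

theorem ψ_eq_of_prefix (h : A.pillars <+: B.pillars) (hI : A.ψ I ≠ none) : B.ψ I = A.ψ I := by
  obtain ⟨L, hL⟩ := h
  rw [ψ_eq, ψ_eq, ← hL, List.reverse_append]
  exact colouringRev_append _ hI

theorem isProperPartialColouring (A : S.PillarAssignment) : S.IsProperPartialColouring A.ψ :=
  isProperPartialColouring_colouringRev (List.nodup_reverse.2 A.nodup)
    fun p hp => A.isPillar p (List.mem_reverse.1 hp)

theorem extends_of_prefix (h : A.pillars <+: B.pillars) : B.Extends A :=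
  ⟨h, B.isProperPartialColouring, fun I _ c hc => by
    rw [ψ_eq_of_prefix h (by simp [hc]), hc]⟩

/-! ### Arches -/

theorem IsArch.nonneg (h : A.IsArch a b) : 0 ≤ a := by
  rcases h.2.1 with h | h | h
  · exact h.ge
  · rw [h]; exact zero_le_one
  · exact (A.isPillar a h).1.1.le

theorem IsArch.le_one (h : A.IsArch a b) : b ≤ 1 := by
  rcases h.2.2.1 with h | h | h
  · rw [h]; exact zero_le_one
  · exact h.le
  · exact (A.isPillar b h).1.2.le

/-- Adding pillars refines the arches. -/
theorem IsArch.le_and_le (hA : A.IsArch a b) (hB : B.IsArch c d)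
    (hAB : ∀ p ∈ A.pillars, p ∈ B.pillars) (hp : p ∈ Ioo a b) (hp' : p ∈ Ioo c d) :
    a ≤ c ∧ d ≤ b := by
  constructor
  · by_contra! hc
    have had : a < d := hp.1.trans hp'.2
    rcases hA.2.1 with h | h | h
    · linarith [hB.nonneg]
    · linarith [hB.le_one]
    · exact hB.2.2.2 a (hAB a h) ⟨hc, had⟩
  · by_contra! hc
    have hcb : c < b := hp'.1.trans hp.2
    rcases hA.2.2.1 with h | h | h
    · linarith [hB.nonneg]
    · linarith [hB.le_one]
    · exact hB.2.2.2 b (hAB b h) ⟨hcb, hc⟩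

theorem exists_isArch (hq : q ∈ Ioo (0 : ℝ) 1) (hqA : q ∉ A.pillars) :
    ∃ a b, A.IsArch a b ∧ q ∈ Ioo a b ∧ foundation A.pillars.reverse q = Ioo a b := by
  obtain ⟨a, b, hF, haq, hqb, ha, hb, hab⟩ :=
    exists_foundation_eq (l := A.pillars.reverse) hq (by simpa using hqA)
  simp only [List.mem_reverse] at ha hb hab
  exact ⟨a, b, ⟨haq.trans hqb, by tauto, by tauto, hab⟩, ⟨haq, hqb⟩, hF⟩

/-- The arches after adding a pillar `q` in the arch `(a, b)`. -/
theorem isArch_snoc {hq : S.IsPillar q} {hqA : q ∉ A.pillars} (hab : A.IsArch a b)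
    (hqab : q ∈ Ioo a b) (h : (A.snoc q hq hqA).IsArch c d) :
    (a ≤ c ∧ d = q) ∨ (c = q ∧ d ≤ b) ∨ (A.IsArch c d ∧ q ∉ Ioo c d ∧ c ≠ q ∧ d ≠ q) := by
  have h0 := h.nonneg
  have h1 := h.le_one
  obtain ⟨hcd, hc, hd, hno⟩ := h
  simp only [mem_snoc] at hc hd hno
  by_cases hdq : d = q
  · refine Or.inl ⟨?_, hdq⟩
    by_contra! hca
    have had : a < d := hdq ▸ hqab.1
    rcases hab.2.1 with h | h | h
    · linarith
    · linarith
    · exact hno a (Or.inl h) ⟨hca, had⟩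
  by_cases hcq : c = q
  · refine Or.inr (Or.inl ⟨hcq, ?_⟩)
    by_contra! hbd
    have hcb : c < b := hcq ▸ hqab.2
    rcases hab.2.2.1 with h | h | h
    · linarith
    · linarith
    · exact hno b (Or.inl h) ⟨hcb, hbd⟩
  · exact Or.inr (Or.inr ⟨⟨hcd, by tauto, by tauto, fun p hp => hno p (Or.inl hp)⟩,
      hno q (Or.inr rfl), hcq, hdq⟩)

/-- Adding a pillar does not change the degrees outside its arch. -/
theorem degree_snoc_le_of_isArch {hq : S.IsPillar q} {hqA : q ∉ A.pillars} (h : A.IsArch c d)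
    (hqcd : q ∉ Ioo c d) (hcq : c ≠ q) (hdq : d ≠ q) {K : Set ℝ} (hK : K ⊆ Ioo c d) :
    (A.snoc q hq hqA).degree K ≤ A.degree K := by
  rw [degree_eq, degree_eq, reverse_snoc]
  refine colDegree_le_of_eq fun I hI => colouringRev_cons_of_notMem fun hIq => ?_
  obtain ⟨hIS, hqI, hno⟩ := mem_assigned.1 hIq
  simp only [List.mem_reverse] at hno
  have h0 := S.nonneg I hIS
  have h1 := S.le_one I hIS
  have hlt := S.lt I hIS
  have hcd := h.1
  have hI' : I.1 ∈ Ioo c d ∨ I.2 ∈ Ioo c d :=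
    (mem_withEndpointIn.1 hI).2.imp (fun h => hK h) fun h => hK h
  rcases lt_or_gt_of_ne hdq with hd | hd
  · -- `q` is to the right of the arch, so `I` would contain `d`
    have hdI : d ∈ Ioo I.1 I.2 := by
      rcases hI' with h | h
      · exact ⟨h.2, hd.trans hqI.2⟩
      · linarith [h.2, hqI.2]
    rcases h.2.2.1 with h | h | h
    · linarith [hdI.1]
    · linarith [hdI.2]
    · exact hno d h hdI
  · have hc : q < c := by
      rcases lt_or_gt_of_ne hcq with hc | hc
      · exact absurd ⟨hc, hd⟩ hqcd
      · exact hc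
    have hcI : c ∈ Ioo I.1 I.2 := by
      rcases hI' with h | h
      · linarith [h.1, hqI.1]
      · exact ⟨hqI.1.trans hc, h.1⟩
    rcases h.2.1 with h | h | h
    · linarith [hcI.1]
    · linarith [hcI.2]
    · exact hno c h hcI

theorem degree_snoc_le {hq : S.IsPillar q} {hqA : q ∉ A.pillars} (K : Set ℝ) :
    (A.snoc q hq hqA).degree K ≤
      A.degree K + cliqueNumber (S.assigned A.pillars.reverse q) := by
  rw [degree_eq, degree_eq, reverse_snoc]
  exact colDegree_cons_le K

theorem degree_mono {K L : Set ℝ} (h : K ⊆ L) : A.degree K ≤ A.degree L := colDegree_mono h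

/-! ### Adding cheap pillars in a balanced order -/

/-- A set of fewer than `2 ^ (k + 1)` points has a point with fewer than `2 ^ k` points on each
side. -/
theorem exists_median {U : Finset ℝ} {k : ℕ} (hU : U.Nonempty) (hcard : U.card < 2 ^ (k + 1)) :
    ∃ q ∈ U, (U.filter (· < q)).card < 2 ^ k ∧ (U.filter (q < ·)).card < 2 ^ k := by
  have hne : (U.filter fun x => (U.filter (· < x)).card < 2 ^ k).Nonempty := by
    obtain ⟨m, hm, hmin⟩ := Finset.exists_min_image U id hU
    refine ⟨m, Finset.mem_filter.2 ⟨hm, ?_⟩⟩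
    rw [Finset.filter_false_of_mem fun x hx => not_lt.2 (show m ≤ x from hmin x hx)]
    simp
  obtain ⟨q, hq, hmax⟩ := Finset.exists_max_image _ id hne
  rw [Finset.mem_filter] at hq
  refine ⟨q, hq.1, hq.2, ?_⟩
  rcases (U.filter (q < ·)).eq_empty_or_nonempty with h | h
  · rw [h]; simp
  obtain ⟨y, hy, hymin⟩ := Finset.exists_min_image _ id h
  rw [Finset.mem_filter] at hy
  -- the points up to `q` are those before the next point `y`
  have hle : 2 ^ k ≤ (U.filter (· ≤ q)).card := by
    by_contra! hlt
    refine absurd (hmax y (Finset.mem_filter.2 ⟨hy.1, ?_⟩)) (not_le.2 hy.2)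
    refine (Finset.card_le_card fun x hx => ?_).trans_lt hlt
    rw [Finset.mem_filter] at hx ⊢
    refine ⟨hx.1, ?_⟩
    by_contra! hqx
    exact absurd (hymin x (Finset.mem_filter.2 ⟨hx.1, hqx⟩)) (not_le.2 hx.2)
  have hsum := Finset.card_filter_add_card_filter_not (s := U) (· ≤ q)
  simp only [not_le] at hsum
  rw [pow_succ] at hcard
  omega

/-- Let `T` be a set of cheap pillars such that each arch has, for some `k`, fewer than `2 ^ k`
elements of `T`, degree at most `19 - 2k`, and pieces (between consecutive elements of `T`) of degree
at most `13 - 2k`. Then all pillars of `T` can be added, and all arches have degree at most `13` in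
the end. In each arch the median comes first: it costs two colours, and halves the number of
remaining pillars. -/
theorem exists_prefix_of_isCheap
    (hS : ∀ U ⊆ S.intervals, (U : Set (ℝ × ℝ)).Pairwise Overlap → U.card ≤ 3) :
    ∀ (n : ℕ) (A : S.PillarAssignment) (T : Finset ℝ), T.card = n →
      (∀ t ∈ T, t ∉ A.pillars ∧ S.IsCheap A.pillars.reverse t) →
      (∀ I c, A.ψ I = some c → c ≤ 19) →
      (∀ a b, A.IsArch a b → ∃ k, (T.filter (· ∈ Ioo a b)).card < 2 ^ k ∧
        A.degree (Ioo a b) + 2 * k ≤ 19 ∧ ∀ c d, a ≤ c → d ≤ b → (∀ t ∈ T, t ∉ Ioo c d) →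
          A.degree (Ioo c d) + 2 * k ≤ 13) →
      ∃ B : S.PillarAssignment, A.pillars <+: B.pillars ∧ (∀ I c, B.ψ I = some c → c ≤ 19) ∧
        (∀ a b, B.IsArch a b → B.degree (Ioo a b) ≤ 13) ∧
        ∀ p, p ∈ B.pillars ↔ p ∈ A.pillars ∨ p ∈ T := by
  intro n
  induction n with
  | zero =>
    intro A T hT _ hcol hdeg
    rw [Finset.card_eq_zero] at hT
    subst hT
    refine ⟨A, List.prefix_rfl, hcol, fun a b hab => ?_, by simp⟩
    obtain ⟨k, -, -, h⟩ := hdeg a b hab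
    have := h a b le_rfl le_rfl (by simp)
    omega
  | succ n ih =>
    intro A T hT hcheap hcol hdeg
    obtain ⟨t, ht⟩ : T.Nonempty := Finset.card_pos.1 (by omega)
    obtain ⟨a, b, hab, htab, -⟩ := exists_isArch (hcheap t ht).2.1.1 (hcheap t ht).1
    obtain ⟨k, hk, hk19, hk13⟩ := hdeg a b hab
    have hne : (T.filter (· ∈ Ioo a b)).Nonempty := ⟨t, Finset.mem_filter.2 ⟨ht, htab⟩⟩
    obtain ⟨k, rfl⟩ : ∃ k', k = k' + 1 := by
      refine Nat.exists_eq_succ_of_ne_zero ?_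
      rintro rfl
      have := Finset.card_pos.2 hne
      omega
    obtain ⟨q, hq, hlow, hhigh⟩ := exists_median hne hk
    rw [Finset.mem_filter] at hq
    obtain ⟨hqT, hqab⟩ := hq
    obtain ⟨hqA, hqc⟩ := hcheap q hqT
    have hw := hqc.cliqueNumber_le hS
    obtain ⟨a', b', hab', hqab', hF⟩ := exists_isArch hqc.1.1 hqA
    obtain ⟨rfl, rfl⟩ : a' = a ∧ b' = b := by
      have h1 := hab.le_and_le hab' (fun _ h => h) hqab hqab'
      have h2 := hab'.le_and_le hab (fun _ h => h) hqab' hqab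
      exact ⟨le_antisymm h2.1 h1.1, le_antisymm h1.2 h2.2⟩
    have hle : ∀ K, (A.snoc q hqc.1 hqA).degree K ≤ A.degree K + 2 := fun K =>
      (degree_snoc_le K).trans (Nat.add_le_add_left hw _)
    have havoid : ∀ {c d : ℝ}, (∀ t ∈ T.erase q, t ∉ Ioo c d) → q ∉ Ioo c d →
        ∀ t ∈ T, t ∉ Ioo c d := by
      intro c d h hqcd t ht
      by_cases htq : t = q
      · rwa [htq]
      · exact h t (Finset.mem_erase.2 ⟨htq, ht⟩)
    have hsnoc := ih (A.snoc q hqc.1 hqA) (T.erase q)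
      (by rw [Finset.card_erase_of_mem hqT]; omega) ?_ ?_ ?_
    · obtain ⟨B, hpre, hBcol, hBdeg, hB⟩ := hsnoc
      refine ⟨B, prefix_snoc.trans hpre, hBcol, hBdeg, fun p => ?_⟩
      rw [hB, mem_snoc, Finset.mem_erase]
      by_cases hpq : p = q
      · subst hpq; tauto
      · tauto
    · intro t ht
      rw [Finset.mem_erase] at ht
      obtain ⟨h1, h2⟩ := hcheap t ht.2
      rw [reverse_snoc, mem_snoc]
      exact ⟨by tauto, h2.cons⟩
    · intro I c hc
      rw [ψ_eq, reverse_snoc] at hc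
      rw [degree_eq] at hk19
      exact le_of_colouringRev_cons_eq hF (by omega) hcol hc
    · intro c d hcd
      rcases isArch_snoc hab hqab hcd with ⟨hac, rfl⟩ | ⟨rfl, hdb⟩ | ⟨hcd', hqcd, hcq, hdq⟩
      · refine ⟨k, lt_of_le_of_lt (Finset.card_le_card fun t ht => ?_) hlow, ?_, ?_⟩
        · simp only [Finset.mem_filter, Finset.mem_erase] at ht ⊢
          exact ⟨⟨ht.1.2, hac.trans_lt ht.2.1, ht.2.2.trans hqab.2⟩, ht.2.2⟩
        · have := hle (Ioo c d)
          have := A.degree_mono (Ioo_subset_Ioo hac hqab.2.le)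
          omega
        · intro c' d' hc' hd' hav
          have := hle (Ioo c' d')
          have := hk13 c' d' (hac.trans hc') (hd'.trans hqab.2.le)
            (havoid hav fun h => absurd h.2 (not_lt.2 hd'))
          omega
      · refine ⟨k, lt_of_le_of_lt (Finset.card_le_card fun t ht => ?_) hhigh, ?_, ?_⟩
        · simp only [Finset.mem_filter, Finset.mem_erase] at ht ⊢
          exact ⟨⟨ht.1.2, hqab.1.trans ht.2.1, ht.2.2.trans_le hdb⟩, ht.2.1⟩
        · have := hle (Ioo c d)
          have := A.degree_mono (Ioo_subset_Ioo hqab.1.le hdb)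
          omega
        · intro c' d' hc' hd' hav
          have := hle (Ioo c' d')
          have := hk13 c' d' (hqab.1.le.trans hc') (hd'.trans hdb)
            (havoid hav fun h => absurd h.1 (not_lt.2 hc'))
          omega
      · obtain ⟨m, h1, h2, h3⟩ := hdeg c d hcd'
        refine ⟨m, lt_of_le_of_lt (Finset.card_le_card
          (Finset.filter_subset_filter _ (Finset.erase_subset _ _))) h1, ?_, ?_⟩
        · have := degree_snoc_le_of_isArch (hq := hqc.1) (hqA := hqA) hcd' hqcd hcq hdq
            (subset_refl (Ioo c d))
          omega
        · intro c' d' hc' hd' hav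
          have hsub := Ioo_subset_Ioo hc' hd'
          have := degree_snoc_le_of_isArch (hq := hqc.1) (hqA := hqA) hcd' hqcd hcq hdq hsub
          have := h3 c' d' hc' hd' (havoid hav fun h => hqcd (hsub h))
          omega

/-! ### Completing a pillar assignment -/

open scoped Classical in
/-- The intervals without a pillar. -/
noncomputable def uncovered (A : S.PillarAssignment) : Finset (ℝ × ℝ) :=
  S.intervals.filter fun I => ∀ p ∈ A.pillars, p ∉ Ioo I.1 I.2

theorem mem_uncovered :
    I ∈ A.uncovered ↔ I ∈ S.intervals ∧ ∀ p ∈ A.pillars, p ∉ Ioo I.1 I.2 := by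
  simp [uncovered]

theorem uncovered_card_lt (hAB : ∀ p ∈ A.pillars, p ∈ B.pillars) (hI : I ∈ A.uncovered)
    (hp : p ∈ B.pillars) (hpI : p ∈ Ioo I.1 I.2) : B.uncovered.card < A.uncovered.card := by
  refine Finset.card_lt_card (Finset.ssubset_iff_of_subset ?_ |>.2 ⟨I, hI, fun h => ?_⟩)
  · intro J hJ
    rw [mem_uncovered] at hJ ⊢
    exact ⟨hJ.1, fun q hq => hJ.2 q (hAB q hq)⟩
  · exact (mem_uncovered.1 h).2 p hp hpI

/-- An incomplete pillar assignment with small degrees has an extension with small degrees and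
fewer uncovered intervals. -/
theorem exists_uncovered_card_lt
    (hS : ∀ U ⊆ S.intervals, (U : Set (ℝ × ℝ)).Pairwise Overlap → U.card ≤ 3)
    (hcol : ∀ I c, A.ψ I = some c → c ≤ 19)
    (hdeg : ∀ a b, A.IsArch a b → A.degree (Ioo a b) ≤ 13) {X : ℝ × ℝ} (hX : X ∈ A.uncovered) :
    ∃ B : S.PillarAssignment, A.pillars <+: B.pillars ∧ (∀ I c, B.ψ I = some c → c ≤ 19) ∧
      (∀ a b, B.IsArch a b → B.degree (Ioo a b) ≤ 13) ∧
      B.uncovered.card < A.uncovered.card := by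
  obtain ⟨hXS, hXno⟩ := mem_uncovered.1 hX
  obtain ⟨x, hxX, hx, -⟩ :=
    S.exists_pillar_before (S.nonneg X hXS) (S.lt X hXS) (S.le_one X hXS)
  have hxA : x ∉ A.pillars := fun h => hXno x h hxX
  obtain ⟨a, b, hab, hxab, -⟩ := exists_isArch hx.1 hxA
  obtain ⟨T, hT8, hT, hT7⟩ := exists_cuts (l := A.pillars.reverse) hS
    (List.nodup_reverse.2 A.nodup) (fun p hp => A.isPillar p (List.mem_reverse.1 hp))
    hab.nonneg hab.le_one (fun p hp => hab.2.2.2 p (List.mem_reverse.1 hp)) (hdeg a b hab)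
  have hTA : ∀ t ∈ T, t ∉ A.pillars := fun t ht h => hab.2.2.2 t h (hT t ht).1
  obtain ⟨B, hpre, hBcol, hBdeg, hB⟩ := exists_prefix_of_isCheap hS _ A T rfl
    (fun t ht => ⟨hTA t ht, (hT t ht).2⟩) hcol (fun c d hcd => by
      by_cases h : ∃ t ∈ T, t ∈ Ioo c d
      · obtain ⟨t, ht, htcd⟩ := h
        have h1 := hab.le_and_le hcd (fun _ h => h) (hT t ht).1 htcd
        refine ⟨3, (Finset.card_filter_le _ _).trans_lt hT8, ?_, fun c' d' hc' hd' hav => ?_⟩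
        · have := hdeg c d hcd
          omega
        · have := hT7 c' d' (h1.1.trans hc') (hd'.trans h1.2) hav
          rw [degree_eq]
          omega
      · push Not at h
        refine ⟨0, ?_, ?_, fun c' d' hc' hd' _ => ?_⟩
        · rw [Finset.filter_false_of_mem h]; simp
        · have := hdeg c d hcd
          omega
        · exact (A.degree_mono (Ioo_subset_Ioo hc' hd')).trans (hdeg c d hcd))
  have hAB : ∀ p ∈ A.pillars, p ∈ B.pillars := fun p hp => (hB p).2 (Or.inl hp)
  by_cases hhit : ∃ t ∈ T, ∃ Y ∈ A.uncovered, t ∈ Ioo Y.1 Y.2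
  · obtain ⟨t, ht, Y, hY, htY⟩ := hhit
    exact ⟨B, hpre, hBcol, hBdeg, uncovered_card_lt hAB hY ((hB t).2 (Or.inr ht)) htY⟩
  -- otherwise no new interval is coloured, and the degrees near `x` drop to seven
  push Not at hhit
  have hψ : ∀ I, B.ψ I = A.ψ I := by
    intro I
    by_cases hI : A.ψ I = none
    · rw [hI]
      by_contra hc
      obtain ⟨hIS, p, hp, hpI⟩ := ψ_ne_none_iff.1 hc
      have hIno : ∀ p ∈ A.pillars, p ∉ Ioo I.1 I.2 := fun p hp hpI =>
        ψ_ne_none_iff.2 ⟨hIS, p, hp, hpI⟩ hI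
      rcases (hB p).1 hp with h | h
      · exact hIno p h hpI
      · exact hhit p h I (mem_uncovered.2 ⟨hIS, hIno⟩) hpI
    · exact ψ_eq_of_prefix hpre hI
  have hxB : x ∉ B.pillars := fun h => ((hB x).1 h).elim hxA fun h => hhit x h X hX hxX
  obtain ⟨c, d, hcd, hxcd, hF⟩ := exists_isArch hx.1 hxB
  have hsub := hab.le_and_le hcd hAB hxab hxcd
  have hB7 : B.degree (Ioo c d) ≤ 7 :=
    (colDegree_le_of_eq fun I _ => hψ I).trans
      (hT7 c d hsub.1 hsub.2 fun t ht => hcd.2.2.2 t ((hB t).2 (Or.inr ht)))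
  have hw : cliqueNumber (S.assigned B.pillars.reverse x) ≤ 3 :=
    cliqueNumber_le fun U hU => hS U fun I hI => (mem_assigned.1 (hU hI)).1
  refine ⟨B.snoc x hx hxB, hpre.trans prefix_snoc, ?_, ?_, ?_⟩
  · intro I k hk
    rw [ψ_eq, reverse_snoc] at hk
    rw [degree_eq] at hB7
    exact le_of_colouringRev_cons_eq hF (by omega) hBcol hk
  · intro c' d' h
    have hle := degree_snoc_le (hq := hx) (hqA := hxB) (Ioo c' d')
    rcases isArch_snoc hcd hxcd h with ⟨hc, rfl⟩ | ⟨rfl, hd⟩ | ⟨h', h1, h2, h3⟩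
    · have := B.degree_mono (Ioo_subset_Ioo hc hxcd.2.le)
      omega
    · have := B.degree_mono (Ioo_subset_Ioo hxcd.1.le hd)
      omega
    · exact (degree_snoc_le_of_isArch h' h1 h2 h3 (subset_refl _)).trans (hBdeg c' d' h')
  · exact uncovered_card_lt (fun p hp => mem_snoc.2 (Or.inl (hAB p hp))) hX
      (mem_snoc.2 (Or.inr rfl)) hxX

theorem exists_isComplete
    (hS : ∀ U ⊆ S.intervals, (U : Set (ℝ × ℝ)).Pairwise Overlap → U.card ≤ 3)
    (hcol : ∀ I c, A.ψ I = some c → c ≤ 19)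
    (hdeg : ∀ a b, A.IsArch a b → A.degree (Ioo a b) ≤ 13) :
    ∃ B : S.PillarAssignment, A.pillars <+: B.pillars ∧ B.IsComplete ∧
      ∀ I c, B.ψ I = some c → c ≤ 19 := by
  induction hN : A.uncovered.card using Nat.strong_induction_on generalizing A with
  | _ N ih =>
  rcases A.uncovered.eq_empty_or_nonempty with h | ⟨X, hX⟩
  · refine ⟨A, List.prefix_rfl, fun I hI => ?_, hcol⟩
    by_contra! hc
    have : I ∈ A.uncovered := mem_uncovered.2 ⟨hI, hc⟩
    rw [h] at this
    simp at this
  · obtain ⟨B, hpre, hBcol, hBdeg, hlt⟩ := exists_uncovered_card_lt hS hcol hdeg hX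
    obtain ⟨C, hpre', hC⟩ := ih _ (hN ▸ hlt) hBcol hBdeg rfl
    exact ⟨C, hpre.trans hpre', hC⟩

/-- As the colours in use form an initial segment of the positive integers, their number bounds
them. -/
theorem le_numColours {c : ℕ} (h : A.ψ I = some c) : c ≤ A.numColours := by
  have hsub : Finset.Icc 1 c ⊆ coloursUsed A.ψ S.intervals := by
    intro d hd
    rw [Finset.mem_Icc] at hd
    obtain ⟨J, hJ⟩ : ∃ J, A.ψ J = some d := by
      rcases hd.2.eq_or_lt with rfl | hlt
      · exact ⟨I, h⟩
      · exact exists_colouringRev_eq_of_lt h hd.1 hlt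
    exact mem_coloursUsed.2 ⟨J, (ψ_ne_none_iff.1 (by rw [hJ]; simp)).1, hJ⟩
  simpa [numColours] using Finset.card_le_card hsub

theorem numColours_le {n : ℕ} (h : ∀ I c, A.ψ I = some c → c ≤ n) : A.numColours ≤ n := by
  have hsub : coloursUsed A.ψ S.intervals ⊆ Finset.Icc 1 n := by
    intro c hc
    obtain ⟨I, -, hI⟩ := mem_coloursUsed.1 hc
    exact Finset.mem_Icc.2 ⟨pos_of_colouringRev_eq_some hI, h I c hI⟩
  simpa [numColours] using Finset.card_le_card hsub

theorem IsComplete.colorable (h : A.IsComplete) : S.overlapGraph.Colorable A.numColours := by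
  have hcol : ∀ I : {I // I ∈ S.intervals}, ∃ c, A.ψ I.1 = some c := fun I =>
    Option.ne_none_iff_exists'.1 (ψ_ne_none_iff.2 ⟨I.2, h I.1 I.2⟩)
  choose f hf using hcol
  let C : S.overlapGraph.Coloring (coloursUsed A.ψ S.intervals) :=
    SimpleGraph.Coloring.mk (fun I => ⟨f I, mem_coloursUsed.2 ⟨I.1, I.2, hf I⟩⟩) (by
      intro I J hIJ heq
      refine A.isProperPartialColouring I.1 I.2 J.1 J.2 hIJ (f I) (hf I) ?_
      rw [hf J, ← Subtype.mk.inj heq])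
  simpa [numColours] using C.colorable

end PillarAssignment

theorem card_le_of_cliqueFree {n : ℕ} (hS : S.overlapGraph.CliqueFree (n + 1))
    {U : Finset (ℝ × ℝ)} (hU : U ⊆ S.intervals) (h : (U : Set (ℝ × ℝ)).Pairwise Overlap) :
    U.card ≤ n := by
  classical
  by_contra! hc
  obtain ⟨W, hWU, hW⟩ := Finset.exists_subset_card_eq hc
  refine hS (W.subtype (· ∈ S.intervals)) ⟨?_, ?_⟩
  · intro I hI J hJ hne
    exact h (hWU (Finset.mem_subtype.1 hI)) (hWU (Finset.mem_subtype.1 hJ))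
      fun h' => hne (Subtype.ext h')
  · rw [Finset.card_subtype, Finset.filter_true_of_mem fun I hI => hU (hWU hI), hW]

end IntervalSystem

theorem mainTheorem4 {V : Type*} (G : SimpleGraph V) (S : IntervalSystem)
    (hGS : Nonempty (G ≃g S.overlapGraph)) (hG : G.CliqueFree 4) :
    (∀ A : S.PillarAssignment, A.numColours ≤ 19 →
      (∀ a b : ℝ, A.IsArch a b → A.degree (Set.Ioo a b) ≤ 13) →
      ∃ B : S.PillarAssignment, B.Extends A ∧ B.IsComplete ∧ B.numColours ≤ 19) ∧
    G.Colorable 19 := by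
  obtain ⟨e⟩ := hGS
  have hfree : S.overlapGraph.CliqueFree 4 := hG.comap ⟨e.symm.toCopy⟩
  have hS : ∀ U ⊆ S.intervals, (U : Set (ℝ × ℝ)).Pairwise Overlap → U.card ≤ 3 :=
    fun U hU h => S.card_le_of_cliqueFree hfree hU h
  have main : ∀ A : S.PillarAssignment, A.numColours ≤ 19 →
      (∀ a b : ℝ, A.IsArch a b → A.degree (Set.Ioo a b) ≤ 13) →
      ∃ B : S.PillarAssignment, B.Extends A ∧ B.IsComplete ∧ B.numColours ≤ 19 := by
    intro A hA hdeg
    obtain ⟨B, hpre, hB, hcol⟩ := IntervalSystem.PillarAssignment.exists_isComplete hS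
      (fun I c hc => (IntervalSystem.PillarAssignment.le_numColours hc).trans hA) hdeg
    exact ⟨B, IntervalSystem.PillarAssignment.extends_of_prefix hpre, hB,
      IntervalSystem.PillarAssignment.numColours_le hcol⟩
  refine ⟨main, ?_⟩
  -- start from the assignment without pillars
  set A : S.PillarAssignment := ⟨[], List.nodup_nil, by simp⟩ with hA
  have hnone : ∀ T, coloursUsed A.ψ T = ∅ := fun T => by
    ext c
    simp [mem_coloursUsed, IntervalSystem.PillarAssignment.ψ_eq, hA, IntervalSystem.colouringRev]
  obtain ⟨B, -, hB, hB19⟩ := main A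
    (by rw [IntervalSystem.PillarAssignment.numColours, hnone]; simp)
    (fun a b _ => by rw [IntervalSystem.PillarAssignment.degree, hnone]; simp)
  exact (hB.colorable.mono hB19).of_hom e.toHom
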